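/- Let $h\ge 2$ and $k\ge 5$ be integers, and let $A$ be a set of $k$ integers with $\min A=0$ and $d(A)=1$, where $d(A)$ is the greatest common divisor of the numbers $a-\min A$, $a\in A$. For a positive integer $n$ let $nA=\{\sum_{a\in A}\lambda_a a:\ \lambda_a\in\mathbb Z_{\ge 0},\ \sum_{a\in A}\lambda_a=n\}$ be the $n$-fold sumset of $A$, and write $[\alpha,\beta]$ for the set of integers from $\alpha$ to $\beta$. Then: (1) If $k\ge 6$, then $|2A|=2k+2$ if and only if $A=[0,k+2]\setminus\{x,y,z\}$, where $\{x,y,z\}$ is one of the sets $\{2,3,k+2\}$, $\{k-2,k-1,k+2\}$, $\{1,i,k+2\}$ with $4\le i\le k-1$, $\{i,k,k+2\}$ with $2\le i\le k-3$, $\{1,2,3\}$, $\{k-1,k,k+1\}$, $\{1,2,4\}$, $\{k-2,k,k+1\}$, $\{1,2,k+1\}$, $\{1,k,k+1\}$, $\{1,2,5\}$, $\{k-3,k,k+1\}$, $\{1,3,5\}$, $\{k-3,k-1,k+1\}$, $\{1,3,k+1\}$, $\{1,k-1,k+1\}$. (2) $|3A|=3k+4$ if and only if $A=[0,k+2]\setminus\{x,y,z\}$,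 where $\{x,y,z\}$ is one of the sets $\{1,2,3\}$, $\{k-1,k,k+1\}$, $\{1,2,4\}$, $\{k-2,k,k+1\}$, $\{1,2,k+1\}$, $\{1,k,k+1\}$, $\{1,2,5\}$, $\{k-3,k,k+1\}$, $\{1,3,5\}$, $\{k-3,k-1,k+1\}$, $\{1,3,k+1\}$, $\{1,k-1,k+1\}$, and $\{i,j,k+2\}$ with $2\le i<j\le k-1$. (3) If $h\ge 4$, then $|hA|=hk+2h-2$ if and only if $A=[0,k+2]\setminus\{x,y,z\}$, where $\{x,y,z\}$ is one of the sets $\{1,2,3\}$, $\{k-1,k,k+1\}$, $\{1,2,4\}$, $\{k-2,k,k+1\}$, $\{1,2,k+1\}$, $\{1,k,k+1\}$, $\{1,2,5\}$, $\{k-3,k,k+1\}$, $\{1,3,5\}$, $\{k-3,k-1,k+1\}$, $\{1,3,k+1\}$, $\{1,k-1,k+1\}$. (4) If $h\ge 4$ and $k\ge 5$, or $h\ge 3$ and $k\ge 6$, then $|hA|=hk+2h-1$ if and only if $A=[0,k+2]\setminus\{x,y,z\}$, where $\{x,y,z\}$ is one of the sets $\{1,3,4\}$, $\{k-2,k-1,k+1\}$,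 $\{1,2,i\}$ with $6\le i\le k$, $\{i,k,k+1\}$ with $2\le i\le k-4$, $\{1,3,i\}$ with $6\le i\le k$, $\{i,k-1,k+1\}$ with $2\le i\le k-4$, and $\{1,i,k+1\}$ with $4\le i\le k-2$. (5) If $h\ge 4$ and $k\ge 6$, or $h\ge 5$ and $k\ge 5$, then $|hA|=hk+2h$ if and only if $A=[0,k+2]\setminus\{x,y,z\}$, where $\{x,y,z\}$ is one of the sets $\{2,3,k+1\}$, $\{1,k-1,k\}$, $\{i,i+1,k+1\}$ with $3\le i\le k-3$, $\{1,i,i+1\}$ with $4\le i\le k-2$, $\{i,i+2,k+1\}$ with $2\le i\le k-4$, $\{1,i,i+2\}$ with $4\le i\le k-2$, $\{1,i,j\}$ with $4\le i\le j-3\le k-3$, and $\{i,j,k+1\}$ with $2\le i\le j-3\le k-5$. (6) If $h\ge 5$ and $k\ge 6$, or $h\ge 6$ and $k\ge 5$, then $|hA|=hk+2h+1$ if and only if $A=[0,k+2]\setminus\{x,y,z\}$ with $2\le x<y<z\le k$. In each list the parameters $i,j$ are integers. -/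

import Mathlib

/-- The `h`-fold sumset `hA` of a finite set `A` of integers: all sums `∑ a ∈ A, l a * a` with
natural coefficients `l a` such that `∑ a ∈ A, l a = h`. (`Finset.piAntidiag A h` is the finset
of all `l : ℤ → ℕ` that vanish outside `A` and satisfy `∑ a ∈ A, l a = h`.) -/
def hFoldSumset (h : ℕ) (A : Finset ℤ) : Finset ℤ :=
  (A.piAntidiag h).image fun l => ∑ a ∈ A, (l a : ℤ) * a

theorem mem_hFoldSumset {h : ℕ} {A : Finset ℤ} {s : ℤ} :
    s ∈ hFoldSumset h A ↔
      ∃ l : ℤ → ℕ, ∑ a ∈ A, l a = h ∧ ∑ a ∈ A, (l a : ℤ) * a = s := by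
  classical
  simp only [hFoldSumset, Finset.mem_image, Finset.mem_piAntidiag]
  constructor
  · rintro ⟨l, ⟨hl, _⟩, hs⟩
    exact ⟨l, hl, hs⟩
  · rintro ⟨l, hl, hs⟩
    refine ⟨fun a => if a ∈ A then l a else 0, ⟨?_, ?_⟩, ?_⟩
    · rw [← hl]
      exact Finset.sum_congr rfl fun a ha => by simp [ha]
    · intro a ha
      by_contra hA
      simp [hA] at ha
    · rw [← hs]
      exact Finset.sum_congr rfl fun a ha => by simp [ha]

/-- `d(A)`: the greatest common divisor (normalised to be nonnegative) of the differences
`a - min A`, `a ∈ A`. -/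
def diffGcd (A : Finset ℤ) (hA : A.Nonempty) : ℤ :=
  A.gcd fun a => a - A.min' hA

/-- The twelve three-element sets `{1,2,3}`, …, `{1,k-1,k+1}` that occur for every `h ≥ 2`. -/
def IsBaseTriple (k : ℤ) (T : Finset ℤ) : Prop :=
  T = {1, 2, 3} ∨ T = {k - 1, k, k + 1} ∨
  T = {1, 2, 4} ∨ T = {k - 2, k, k + 1} ∨
  T = {1, 2, k + 1} ∨ T = {1, k, k + 1} ∨
  T = {1, 2, 5} ∨ T = {k - 3, k, k + 1} ∨
  T = {1, 3, 5} ∨ T = {k - 3, k - 1, k + 1} ∨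
  T = {1, 3, k + 1} ∨ T = {1, k - 1, k + 1}

/-! Compare max A with k+2.

If max A ≤ k+2, then A is [0, k+2] with three positive points removed, and the missing sums can be
counted. When k+2 ∈ A, every integer in [6, h(k+2)-6] lies in hA, because such an n has more
disjoint representations than three removed points can destroy (`IsPunctured.mem_of_middle`). So
sums are missing only in the five positions next to each end, and |hA| = h(k+2)+1-L-R. Here L is
determined by A ∩ [1,5], and R is the same count for the reflection k+2-A
(`IsPunctured.card_hFoldSumset`). The values of L stabilise from h = 4 on, and solving L+R = 3, 2,
1, 0 gives the lists. When k+2 is removed, |hA| ≤ h(k+1)+1, so this case contributes only for h = 2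
and h = 3.

If n = max A ≥ k+3, both sides of every equivalence are false. Let S be the image of A in ℤ/n, with
k-1 elements. Each residue class met by (h+1)A contains an element outside hA, so |(h+1)A| ≥ |hA| +
|(h+1)S|. An isoperimetric argument bounds |2S| and |3S| from below, and `hFoldSumset_card_of_long`
follows: |2A| ≥ min(2k+3, 3k-3), and each later step adds at least k+3. The side conditions on h and
k in the last three items are exactly those under which this bound exceeds the listed value. -/

open scoped Pointwise

/-! ### Isoperimetry in finite abelian groups -/

/-- The isoperimetric method: if some nonempty translate sum `X + S` is not everything,
then the least value of `|X + S| - |X|` over such `X` is attained at a subgroup. -/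
theorem exists_addSubgroup_isoperimetric {G : Type*} [AddCommGroup G] [Fintype G] [DecidableEq G]
    (S : Finset G) (hex : ∃ X : Finset G, X.Nonempty ∧ X + S ≠ Finset.univ) :
    ∃ (K : AddSubgroup G) (H : Finset G), (∀ x, x ∈ H ↔ x ∈ K) ∧ H + S ≠ Finset.univ ∧
      ∀ X : Finset G, X.Nonempty → X + S ≠ Finset.univ →
        (X.card : ℤ) + (H + S).card ≤ (X + S).card + H.card := by
  classical
  set F : Finset (Finset G) :=
    Finset.univ.filter fun X => X.Nonempty ∧ X + S ≠ Finset.univ with hF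
  have memF : ∀ X, X ∈ F ↔ X.Nonempty ∧ X + S ≠ Finset.univ := fun X => by simp [hF]
  set f : Finset G → ℤ := fun X => ((X + S).card : ℤ) - X.card with hf
  have hFne : F.Nonempty := by
    obtain ⟨X, hX⟩ := hex
    exact ⟨X, (memF X).2 hX⟩
  obtain ⟨M, hMF, hM⟩ := Finset.exists_min_image F f hFne
  -- Among the minimisers of f, take X of least cardinality (an atom).
  obtain ⟨X, hXF', hXmin'⟩ := Finset.exists_min_image (F.filter fun X => f X = f M)
    Finset.card ⟨M, by simp [hMF]⟩
  have hXF : X ∈ F := (Finset.mem_filter.1 hXF').1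
  have hXf : f X = f M := (Finset.mem_filter.1 hXF').2
  have hmin : ∀ Y ∈ F, f X ≤ f Y := fun Y hY => hXf ▸ hM Y hY
  have hatom : ∀ Y ∈ F, f Y ≤ f X → X.card ≤ Y.card := fun Y hY h =>
    hXmin' Y (Finset.mem_filter.2 ⟨hY, le_antisymm (hXf ▸ h) (hM Y hY)⟩)
  -- Duality: Y = -(X+S)ᶜ satisfies Y+S ⊆ (-X)ᶜ, so it is again a minimiser, and |X| ≤ |Y| by the
  -- choice of X.
  have hdual : (X + S).card + X.card ≤ Fintype.card G := by
    obtain ⟨hXne, hXS⟩ := (memF X).1 hXF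
    set Y : Finset G := -(X + S)ᶜ with hY
    have hYne : Y.Nonempty := by
      rw [hY, Finset.neg_nonempty_iff, Finset.nonempty_iff_ne_empty]
      simpa [Finset.compl_eq_empty_iff] using hXS
    have hsub : Y + S ⊆ (-X)ᶜ := by
      intro u hu
      obtain ⟨y, hy, s, hs, rfl⟩ := Finset.mem_add.1 hu
      rw [hY, Finset.mem_neg'] at hy
      rw [Finset.mem_compl] at hy ⊢
      intro hcon
      apply hy
      rw [Finset.mem_neg'] at hcon
      exact Finset.mem_add.2 ⟨_, hcon, s, hs, by abel⟩
    have hc : (Y + S).card ≤ Fintype.card G - X.card := by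
      have := Finset.card_le_card hsub
      rwa [Finset.card_compl, Finset.card_neg] at this
    have hYc : Y.card = Fintype.card G - (X + S).card := by
      rw [hY, Finset.card_neg, Finset.card_compl]
    have h1 : (X + S).card ≤ Fintype.card G := Finset.card_le_univ _
    have h2 : X.card ≤ Fintype.card G := Finset.card_le_univ _
    have hX0 : 0 < X.card := hXne.card_pos
    have hYF : Y ∈ F := by
      refine (memF Y).2 ⟨hYne, fun h => ?_⟩
      rw [h, Finset.card_univ] at hc
      omega
    have := hatom Y hYF (by simp only [hf]; omega)
    omega
  -- f is submodular. A smaller nonempty intersection has strictly larger f, which pushes f of the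
  -- union below the minimum; `hdual` guarantees that the union is still admissible.
  have hinter : ∀ Z ∈ F, f Z = f X → Z.card = X.card → (X ∩ Z).Nonempty → X = Z := by
    intro Z hZ hZf hZc hne
    by_contra hXZ
    obtain ⟨hXne, hXS⟩ := (memF X).1 hXF
    have hsub : (X ∩ Z) + S ⊆ (X + S) ∩ (Z + S) := Finset.inter_add_subset
    have hIF : X ∩ Z ∈ F := by
      refine (memF _).2 ⟨hne, fun h => hXS ?_⟩
      have := hsub.trans Finset.inter_subset_left
      rw [h] at this
      exact Finset.univ_subset_iff.1 this
    have hlt : (X ∩ Z).card < X.card := by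
      apply Finset.card_lt_card
      refine ⟨Finset.inter_subset_left, fun h => hXZ ?_⟩
      exact Finset.eq_of_subset_of_card_le (h.trans Finset.inter_subset_right) hZc.le
    have hI : f X < f (X ∩ Z) := by
      by_contra h
      have := hatom _ hIF (not_lt.1 h)
      omega
    have hUS : (X ∪ Z) + S = (X + S) ∪ (Z + S) := Finset.union_add
    have e1 := Finset.card_union_add_card_inter (X + S) (Z + S)
    have e2 := Finset.card_union_add_card_inter X Z
    have e3 := Finset.card_le_card hsub
    have hi0 := hne.card_pos
    rw [← hUS] at e1
    simp only [hf] at hI hZf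
    have hUF : X ∪ Z ∈ F := by
      refine (memF _).2 ⟨hXne.mono Finset.subset_union_left, fun h => ?_⟩
      rw [h, Finset.card_univ] at e1
      omega
    have hU := hmin _ hUF
    simp only [hf] at hU
    omega
  have htrans : ∀ g : G, (g +ᵥ X) ∈ F ∧ f (g +ᵥ X) = f X ∧ (g +ᵥ X).card = X.card := by
    intro g
    obtain ⟨hXne, hXS⟩ := (memF X).1 hXF
    have e : (g +ᵥ X) + S = g +ᵥ (X + S) := vadd_add_assoc g X S
    refine ⟨(memF _).2 ⟨hXne.vadd_finset, fun h => hXS ?_⟩, ?_, Finset.card_vadd_finset _ _⟩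
    · rw [e] at h
      apply Finset.eq_univ_of_card
      rw [← Finset.card_vadd_finset g, h, Finset.card_univ]
    · simp only [hf, e, Finset.card_vadd_finset]
  obtain ⟨a, ha⟩ := ((memF X).1 hXF).1
  -- Translation by z-y takes y to z, so the translate meets X and equals it. Hence X is a coset.
  have hstep : ∀ x ∈ X, ∀ y ∈ X, ∀ z ∈ X, x - y + z ∈ X := by
    intro x hx y hy z hz
    obtain ⟨h1, h2, h3⟩ := htrans (z - y)
    have hmem : ∀ w ∈ X, z - y + w ∈ (z - y) +ᵥ X := fun w hw =>
      Finset.mem_vadd_finset.2 ⟨w, hw, rfl⟩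
    have := hinter _ h1 h2 h3 ⟨z, Finset.mem_inter.2 ⟨hz, by simpa using hmem y hy⟩⟩
    rw [this]
    have h := hmem x hx
    rwa [show z - y + x = x - y + z by abel] at h
  obtain ⟨h1, h2, h3⟩ := htrans (-a)
  have hmemH : ∀ x, x ∈ (-a) +ᵥ X ↔ a + x ∈ X := fun x => by
    rw [Finset.mem_vadd_finset]
    constructor
    · rintro ⟨y, hy, rfl⟩
      simpa using hy
    · intro h
      exact ⟨_, h, by simp⟩
  refine ⟨AddSubgroup.ofSub {x | a + x ∈ X} ⟨0, by simpa using ha⟩ ?_, (-a) +ᵥ X, ?_,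
    ((memF _).1 h1).2, ?_⟩
  · intro x hx y hy
    have := hstep _ hx _ hy a ha
    change a + (x + -y) ∈ X
    rwa [show a + x - (a + y) + a = a + (x + -y) by abel] at this
  · exact hmemH
  · intro Y hY hYS
    have := hmin Y ((memF Y).2 ⟨hY, hYS⟩)
    rw [← h2] at this
    simp only [hf] at this
    omega

/-- H+S is a union of at least two cosets of H, because S generates G. So |H+S|-|H| is at least both
|H| and |S|-|H|: at least |S|-1 if |H| = 1, and at least 2 otherwise. With three cosets the 2
becomes 4. With only two, S lies in K ∪ (g+K), and g+g ∈ K would make this union a subgroup, hence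
G, against H+S ≠ G. -/
theorem card_add_of_generating {G : Type*} [AddCommGroup G] [Fintype G] [DecidableEq G]
    {S : Finset G} (h0 : 0 ∈ S) (hgen : ∀ K : AddSubgroup G, (∀ s ∈ S, s ∈ K) → K = ⊤)
    (hS : S + S ≠ Finset.univ) :
    (∀ X : Finset G, X.Nonempty → X + S ≠ Finset.univ →
      X.card + min (S.card - 1) 2 ≤ (X + S).card) ∧
    (S.card + min (S.card - 1) 4 ≤ (S + S).card ∨
      ∃ (K : AddSubgroup G) (g : G), g ∉ K ∧ g + g ∉ K ∧ ∀ s ∈ S, s ∈ K ∨ s - g ∈ K) := by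
  classical
  obtain ⟨K, H, hK, hHS, hmin⟩ := exists_addSubgroup_isoperimetric S ⟨S, ⟨0, h0⟩, hS⟩
  have hcoset : ∀ g : G, ∀ x, x ∈ g +ᵥ H ↔ x - g ∈ K := fun g x => by
    rw [Finset.mem_vadd_finset, ← hK]
    constructor
    · rintro ⟨y, hy, rfl⟩
      simpa using hy
    · intro h
      exact ⟨_, h, by simp⟩
  have hsub : ∀ g ∈ S, g +ᵥ H ⊆ H + S := fun g hg x hx => by
    obtain ⟨y, hy, rfl⟩ := Finset.mem_vadd_finset.1 hx
    exact Finset.mem_add.2 ⟨y, hy, g, hg, add_comm _ _⟩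
  have hne : K ≠ ⊤ := by
    rintro rfl
    apply hHS
    rw [Finset.eq_univ_iff_forall]
    exact fun x => hsub 0 h0 ((hcoset _ _).2 (AddSubgroup.mem_top _))
  obtain ⟨g, hgS, hgK⟩ : ∃ g ∈ S, g ∉ K := by
    by_contra! h
    exact hne (hgen K h)
  have hd2 : Disjoint ((0 : G) +ᵥ H) (g +ᵥ H) := by
    rw [Finset.disjoint_left]
    intro x h1 h2
    rw [hcoset] at h1 h2
    apply hgK
    have := K.sub_mem h1 h2
    simpa using this
  have hc2 : 2 * H.card ≤ (H + S).card := by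
    have := Finset.card_le_card (Finset.union_subset (hsub 0 h0) (hsub g hgS))
    rw [Finset.card_union_of_disjoint hd2, Finset.card_vadd_finset, Finset.card_vadd_finset] at this
    omega
  have hH0 : 0 < H.card := Finset.card_pos.2 ⟨0, (hK 0).2 K.zero_mem⟩
  have hHS' : S.card ≤ (H + S).card :=
    Finset.card_le_card_add_left ⟨0, (hK 0).2 K.zero_mem⟩
  refine ⟨fun X hX hXS => ?_, ?_⟩
  · have := hmin X hX hXS
    omega
  · by_cases h3 : ∀ s ∈ S, s ∈ K ∨ s - g ∈ K
    · refine Or.inr ⟨K, g, hgK, fun hgg => hHS ?_, h3⟩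
      have hcl : ∀ x, x ∈ K ∨ x - g ∈ K := by
        let L : AddSubgroup G := AddSubgroup.ofSub {x | x ∈ K ∨ x - g ∈ K}
          ⟨0, Or.inl K.zero_mem⟩ (by
            rintro x (hx | hx) y (hy | hy)
            · exact Or.inl (by simpa [sub_eq_add_neg] using K.sub_mem hx hy)
            · refine Or.inr ?_
              have := K.sub_mem (K.sub_mem hx hy) hgg
              rwa [show x - (y - g) - (g + g) = x + -y - g by abel] at this
            · refine Or.inr ?_
              have := K.sub_mem hx hy
              rwa [show x - g - y = x + -y - g by abel] at this
            · refine Or.inl ?_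
              have := K.sub_mem hx hy
              rwa [show x - g - (y - g) = x + -y by abel] at this)
        have hL : L = ⊤ := hgen L h3
        intro x
        have : x ∈ L := hL ▸ AddSubgroup.mem_top x
        exact this
      rw [Finset.eq_univ_iff_forall]
      intro x
      rcases hcl x with h | h
      · exact hsub 0 h0 ((hcoset _ _).2 (by simpa using h))
      · exact hsub g hgS ((hcoset _ _).2 h)
    · left
      push Not at h3
      obtain ⟨t, htS, htK, htg⟩ := h3
      have hd3 : Disjoint (((0 : G) +ᵥ H) ∪ (g +ᵥ H)) (t +ᵥ H) := by
        rw [Finset.disjoint_left]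
        intro x h1 h2
        rw [Finset.mem_union] at h1
        rw [hcoset] at h2
        rcases h1 with h1 | h1
        · rw [hcoset] at h1
          apply htK
          simpa using K.sub_mem h1 h2
        · rw [hcoset] at h1
          apply htg
          simpa using K.sub_mem h1 h2
      have hc3 : 3 * H.card ≤ (H + S).card := by
        have := Finset.card_le_card (Finset.union_subset
          (Finset.union_subset (hsub 0 h0) (hsub g hgS)) (hsub t htS))
        rw [Finset.card_union_of_disjoint hd3, Finset.card_union_of_disjoint hd2,
          Finset.card_vadd_finset, Finset.card_vadd_finset, Finset.card_vadd_finset] at this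
        omega
      have := hmin S ⟨0, h0⟩ hS
      omega

/-! ### Recursion for sumsets -/

theorem hFoldSumset_zero (A : Finset ℤ) : hFoldSumset 0 A = 0 := by
  ext s
  rw [mem_hFoldSumset, Finset.mem_zero]
  constructor
  · rintro ⟨l, hl, rfl⟩
    rw [Finset.sum_eq_zero_iff] at hl
    exact Finset.sum_eq_zero fun a ha => by simp [hl a ha]
  · rintro rfl
    exact ⟨0, by simp, by simp⟩

theorem hFoldSumset_succ (h : ℕ) (A : Finset ℤ) :
    hFoldSumset (h + 1) A = hFoldSumset h A + A := by
  ext s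
  rw [mem_hFoldSumset, Finset.mem_add]
  constructor
  · rintro ⟨l, hl, rfl⟩
    obtain ⟨a, ha, hla⟩ : ∃ a ∈ A, l a ≠ 0 := by
      by_contra! hcon
      rw [Finset.sum_eq_zero hcon] at hl
      omega
    obtain ⟨m, hm⟩ := Nat.exists_eq_succ_of_ne_zero hla
    have e : ∀ b, l b = Function.update l a m b + if b = a then 1 else 0 := by
      intro b
      by_cases hb : b = a
      · subst hb
        simp [hm]
      · simp [hb]
    refine ⟨∑ b ∈ A, (Function.update l a m b : ℤ) * b, mem_hFoldSumset.2 ⟨_, ?_, rfl⟩, a, ha, ?_⟩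
    · rw [Finset.sum_congr rfl fun b _ => e b, Finset.sum_add_distrib] at hl
      simpa [ha] using hl
    · rw [Finset.sum_congr rfl fun b _ => congrArg (fun t : ℕ => (t : ℤ) * b) (e b)]
      simp [add_mul, Finset.sum_add_distrib, ha]
  · rintro ⟨u, hu, a, ha, rfl⟩
    obtain ⟨l, hl, rfl⟩ := mem_hFoldSumset.1 hu
    refine ⟨fun b => l b + if b = a then 1 else 0, ?_, ?_⟩
    · simp [Finset.sum_add_distrib, ha, hl]
    · simp [add_mul, Finset.sum_add_distrib, ha]

theorem hFoldSumset_one (A : Finset ℤ) : hFoldSumset 1 A = A := by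
  rw [hFoldSumset_succ, hFoldSumset_zero, zero_add]

theorem hFoldSumset_two (A : Finset ℤ) : hFoldSumset 2 A = A + A := by
  rw [hFoldSumset_succ, hFoldSumset_one]

theorem hFoldSumset_subset_succ {A : Finset ℤ} (h0 : 0 ∈ A) (h : ℕ) :
    hFoldSumset h A ⊆ hFoldSumset (h + 1) A := by
  rw [hFoldSumset_succ]
  exact fun x hx => Finset.mem_add.2 ⟨x, hx, 0, h0, add_zero x⟩

theorem hFoldSumset_mono {A : Finset ℤ} (h0 : 0 ∈ A) : Monotone fun h => hFoldSumset h A :=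
  monotone_nat_of_le_succ (hFoldSumset_subset_succ h0)

theorem hFoldSumset_subset_Icc {A : Finset ℤ} {l : ℤ} (hA : A ⊆ Finset.Icc 0 l) (h : ℕ) :
    hFoldSumset h A ⊆ Finset.Icc 0 (h * l) := by
  induction h with
  | zero =>
    intro x hx
    rw [hFoldSumset_zero, Finset.mem_zero] at hx
    simp [hx]
  | succ h ih =>
    rw [hFoldSumset_succ]
    intro x hx
    obtain ⟨u, hu, a, ha, rfl⟩ := Finset.mem_add.1 hx
    have h1 := Finset.mem_Icc.1 (ih hu)
    have h2 := Finset.mem_Icc.1 (hA ha)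
    rw [Finset.mem_Icc]
    push_cast
    constructor <;> linarith

/-! ### Growth of hA when max A ≥ k+3 -/

/-- The largest element m of (h+1)A in a residue class mod l is not in hA, since otherwise m+l would
be a larger one. -/
theorem hFoldSumset_card_add_card_image_le {A : Finset ℤ} {l : ℤ} {n : ℕ} (hl : (n : ℤ) = l)
    (hl0 : 0 < l) (h0 : 0 ∈ A) (hlA : l ∈ A) (h : ℕ) :
    (hFoldSumset h A).card + ((hFoldSumset (h + 1) A).image (Int.cast : ℤ → ZMod n)).card ≤
      (hFoldSumset (h + 1) A).card := by
  classical
  set P := hFoldSumset (h + 1) A with hP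
  set B := hFoldSumset h A with hB
  have hBP : B ⊆ P := hFoldSumset_subset_succ h0 h
  have hsub : P.image (Int.cast : ℤ → ZMod n) ⊆ (P \ B).image (Int.cast : ℤ → ZMod n) := by
    intro c hc
    obtain ⟨p, hp, rfl⟩ := Finset.mem_image.1 hc
    obtain ⟨m, hm, hmax⟩ := Finset.exists_max_image
      (P.filter fun q => ((q : ℤ) : ZMod n) = p) id ⟨p, by simp [hp]⟩
    rw [Finset.mem_filter] at hm
    refine Finset.mem_image.2 ⟨m, Finset.mem_sdiff.2 ⟨hm.1, fun hmB => ?_⟩, hm.2⟩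
    have hml : m + l ∈ P := by
      rw [hP, hFoldSumset_succ]
      exact Finset.add_mem_add hmB hlA
    have := hmax (m + l) (Finset.mem_filter.2 ⟨hml, by
      rw [← hl]
      simp [hm.2]⟩)
    simp only [id] at this
    linarith
  have h1 := (Finset.card_le_card hsub).trans Finset.card_image_le
  rw [Finset.card_sdiff_of_subset hBP] at h1
  have h2 := Finset.card_le_card hBP
  omega

/-- X+X, X+Y and Y+Y lie over the distinct cosets K, g+K and 2g+K, so |2A| ≥ (2|X|-1) + (|X|+|Y|-1)
+ (2|Y|-1). -/
theorem card_add_self_of_two_classes {G : Type*} [AddCommGroup G] {A : Finset ℤ} (φ : ℤ →+ G)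
    {K : AddSubgroup G} {g : G} (hg : g ∉ K) (hgg : g + g ∉ K)
    (hA : ∀ a ∈ A, φ a ∈ K ∨ φ a - g ∈ K) (hK : ∃ a ∈ A, φ a ∈ K) (hK' : ∃ a ∈ A, φ a ∉ K) :
    3 * A.card ≤ (A + A).card + 3 := by
  classical
  set X := A.filter fun a => φ a ∈ K with hX
  set Y := A.filter fun a => φ a ∉ K with hY
  have hXY : X.card + Y.card = A.card := Finset.card_filter_add_card_filter_not _
  have hXne : X.Nonempty := by
    obtain ⟨a, ha, h⟩ := hK
    exact ⟨a, Finset.mem_filter.2 ⟨ha, h⟩⟩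
  have hYne : Y.Nonempty := by
    obtain ⟨a, ha, h⟩ := hK'
    exact ⟨a, Finset.mem_filter.2 ⟨ha, h⟩⟩
  have hXA : X ⊆ A := Finset.filter_subset _ _
  have hYA : Y ⊆ A := Finset.filter_subset _ _
  have hXm : ∀ a ∈ X, φ a ∈ K := fun a ha => (Finset.mem_filter.1 ha).2
  have hYm : ∀ a ∈ Y, φ a - g ∈ K := fun a ha =>
    (hA a (hYA ha)).resolve_left (Finset.mem_filter.1 ha).2
  have c1 := cauchy_davenport_add_of_linearOrder_isCancelAdd hXne hXne
  have c2 := cauchy_davenport_add_of_linearOrder_isCancelAdd hXne hYne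
  have c3 := cauchy_davenport_add_of_linearOrder_isCancelAdd hYne hYne
  have m1 : ∀ s ∈ X + X, φ s ∈ K := by
    intro s hs
    obtain ⟨a, ha, b, hb, rfl⟩ := Finset.mem_add.1 hs
    rw [map_add]
    exact K.add_mem (hXm a ha) (hXm b hb)
  have m2 : ∀ s ∈ X + Y, φ s - g ∈ K := by
    intro s hs
    obtain ⟨a, ha, b, hb, rfl⟩ := Finset.mem_add.1 hs
    rw [map_add, add_sub_assoc]
    exact K.add_mem (hXm a ha) (hYm b hb)
  have m3 : ∀ s ∈ Y + Y, φ s - (g + g) ∈ K := by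
    intro s hs
    obtain ⟨a, ha, b, hb, rfl⟩ := Finset.mem_add.1 hs
    rw [map_add, add_sub_add_comm]
    exact K.add_mem (hYm a ha) (hYm b hb)
  have d1 : Disjoint (X + X) (X + Y) := by
    rw [Finset.disjoint_left]
    intro s h1 h2
    apply hg
    simpa using K.sub_mem (m1 s h1) (m2 s h2)
  have d2 : Disjoint ((X + X) ∪ (X + Y)) (Y + Y) := by
    rw [Finset.disjoint_left]
    intro s h1 h2
    rcases Finset.mem_union.1 h1 with h1 | h1
    · apply hgg
      simpa using K.sub_mem (m1 s h1) (m3 s h2)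
    · apply hg
      have := K.sub_mem (m2 s h1) (m3 s h2)
      rwa [show φ s - g - (φ s - (g + g)) = g by abel] at this
  have hsub : ((X + X) ∪ (X + Y)) ∪ (Y + Y) ⊆ A + A :=
    Finset.union_subset (Finset.union_subset (Finset.add_subset_add hXA hXA)
      (Finset.add_subset_add hXA hYA)) (Finset.add_subset_add hYA hYA)
  have hcard := Finset.card_le_card hsub
  rw [Finset.card_union_of_disjoint d2, Finset.card_union_of_disjoint d1] at hcard
  have := hXne.card_pos
  have := hYne.card_pos
  omega

/-- The sumset growth for a normalised set whose largest element `n` is at least `|A| + 3`. -/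
theorem hFoldSumset_card_of_long {A : Finset ℤ} {n : ℕ} (hk : 5 ≤ A.card)
    (h0 : 0 ∈ A) (hn : (n : ℤ) ∈ A) (hA : A ⊆ Finset.Icc 0 (n : ℤ)) (hnk : A.card + 3 ≤ n)
    (hgcd : ∀ d : ℤ, (∀ a ∈ A, d ∣ a) → IsUnit d) :
    min (2 * A.card + 3) (3 * A.card - 3) ≤ (hFoldSumset 2 A).card ∧
    ∀ h, 2 ≤ h → (hFoldSumset h A).card + (A.card + 3) ≤ (hFoldSumset (h + 1) A).card := by
  classical
  have : NeZero n := ⟨by omega⟩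
  set φ : ℤ →+ ZMod n := Int.castAddHom (ZMod n) with hφ
  set S : Finset (ZMod n) := A.image φ with hS
  have hS0 : 0 ∈ S := Finset.mem_image.2 ⟨0, h0, map_zero _⟩
  have hgen : ∀ K : AddSubgroup (ZMod n), (∀ s ∈ S, s ∈ K) → K = ⊤ := by
    intro K hK
    obtain ⟨d, hd⟩ := Int.subgroup_cyclic (K.comap φ)
    have hdA : ∀ a ∈ A, d ∣ a := by
      intro a ha
      have : a ∈ K.comap φ := hK _ (Finset.mem_image_of_mem _ ha)
      rw [hd] at this
      obtain ⟨m, rfl⟩ := AddSubgroup.mem_closure_singleton.1 this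
      exact Dvd.intro_left m rfl
    have hu := hgcd d hdA
    rw [AddSubgroup.eq_top_iff']
    intro x
    obtain ⟨z, rfl⟩ := ZMod.intCast_surjective x
    have : z ∈ K.comap φ := by
      obtain ⟨m, rfl⟩ : d ∣ z := hu.dvd
      rw [hd]
      exact AddSubgroup.mem_closure_singleton.2 ⟨m, mul_comm m d⟩
    exact this
  -- Only 0 and n coincide modulo n.
  have hSc : S.card = A.card - 1 := by
    have e : S = (A.erase n).image φ := by
      apply Finset.Subset.antisymm
      · intro s hs
        obtain ⟨a, ha, rfl⟩ := Finset.mem_image.1 hs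
        by_cases han : a = n
        · subst han
          exact Finset.mem_image.2 ⟨0, Finset.mem_erase.2 ⟨by omega, h0⟩, by simp [hφ]⟩
        · exact Finset.mem_image_of_mem _ (Finset.mem_erase.2 ⟨han, ha⟩)
      · exact Finset.image_subset_image (Finset.erase_subset _ _)
    rw [e, Finset.card_image_of_injOn, Finset.card_erase_of_mem hn]
    intro a ha b hb hab
    have ha' := Finset.mem_erase.1 (Finset.mem_coe.1 ha)
    have hb' := Finset.mem_erase.1 (Finset.mem_coe.1 hb)
    have ha2 := Finset.mem_Icc.1 (hA ha'.2)
    have hb2 := Finset.mem_Icc.1 (hA hb'.2)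
    have h1 : a % n = b % n := (ZMod.intCast_eq_intCast_iff' a b n).1 hab
    rwa [Int.emod_eq_of_lt ha2.1 (lt_of_le_of_ne ha2.2 ha'.1),
      Int.emod_eq_of_lt hb2.1 (lt_of_le_of_ne hb2.2 hb'.1)] at h1
  have hstep := hFoldSumset_card_add_card_image_le rfl (by omega : (0 : ℤ) < n) h0 hn
  have himg : ∀ h, (hFoldSumset (h + 1) A).image φ = (hFoldSumset h A).image φ + S := fun h => by
    rw [hFoldSumset_succ, Finset.image_add]
  have himg2 : (hFoldSumset 2 A).image φ = S + S := by rw [himg, hFoldSumset_one]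
  have huniv : (Finset.univ : Finset (ZMod n)).card = n := by rw [Finset.card_univ, ZMod.card]
  have h1 := hstep 1
  change _ + ((hFoldSumset 2 A).image φ).card ≤ _ at h1
  rw [himg2, hFoldSumset_one] at h1
  change A.card + (S + S).card ≤ (hFoldSumset 2 A).card at h1
  have himg_mono : ∀ h, 2 ≤ h → (hFoldSumset 3 A).image φ ⊆ (hFoldSumset (h + 1) A).image φ :=
    fun h hh => Finset.image_subset_image (hFoldSumset_mono h0 (by omega))
  have key : ∀ c, c ≤ (S + S + S).card → ∀ h, 2 ≤ h →
      (hFoldSumset h A).card + c ≤ (hFoldSumset (h + 1) A).card := by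
    intro c hc h hh
    have e1 := hstep h
    change _ + ((hFoldSumset (h + 1) A).image φ).card ≤ _ at e1
    have e2 := Finset.card_le_card (himg_mono h hh)
    rw [himg, himg2] at e2
    omega
  have hSS : S ⊆ S + S := fun s hs => Finset.mem_add.2 ⟨s, hs, 0, hS0, add_zero s⟩
  have hSSS : S + S ⊆ S + S + S := fun s hs => Finset.mem_add.2 ⟨s, hs, 0, hS0, add_zero s⟩
  by_cases hfull : S + S = Finset.univ
  · rw [hfull, huniv] at h1
    refine ⟨by omega, key _ ?_⟩
    have := Finset.card_le_card hSSS
    rw [hfull, huniv] at this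
    rw [hfull]
    omega
  · obtain ⟨hall, htwo⟩ := card_add_of_generating hS0 hgen hfull
    have hs2 := hall S ⟨0, hS0⟩ hfull
    -- Adding |A| to |S| + min(|S|-1, 4) with |S| = k-1 gives min(3k-3, 2k+3). The two-coset case
    -- gives 3k-3 directly in ℤ.
    constructor
    · rcases htwo with h | ⟨K, g, hg, hgg, hcl⟩
      · omega
      · have := card_add_self_of_two_classes (A := A) φ hg hgg
          (fun a ha => hcl _ (Finset.mem_image_of_mem _ ha))
          ⟨0, h0, by rw [map_zero]; exact K.zero_mem⟩ (by
            by_contra! hcon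
            apply hg
            rw [hgen K fun s hs => ?_]
            · exact AddSubgroup.mem_top g
            · obtain ⟨a, ha, rfl⟩ := Finset.mem_image.1 hs
              exact hcon a ha)
        rw [hFoldSumset_two]
        omega
    · apply key
      by_cases hfull3 : S + S + S = Finset.univ
      · rw [hfull3, huniv]
        exact hnk
      -- |3S| ≥ |2S|+2 ≥ |S|+4 = k+3.
      · have := hall (S + S) ⟨0, hSS hS0⟩ hfull3
        omega

/-! ### Punctured intervals: sums are missing only near the ends -/

theorem mem_hFoldSumset_succ {A : Finset ℤ} {h : ℕ} {s : ℤ} :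
    s ∈ hFoldSumset (h + 1) A ↔ ∃ a ∈ A, s - a ∈ hFoldSumset h A := by
  rw [hFoldSumset_succ, Finset.mem_add]
  constructor
  · rintro ⟨u, hu, a, ha, rfl⟩
    exact ⟨a, ha, by simpa using hu⟩
  · rintro ⟨a, ha, h⟩
    exact ⟨_, h, a, ha, by ring⟩

theorem mem_hFoldSumset_two {A : Finset ℤ} {s : ℤ} :
    s ∈ hFoldSumset 2 A ↔ ∃ a ∈ A, s - a ∈ A := by
  rw [mem_hFoldSumset_succ, hFoldSumset_one]

/-- Lets the upper end of hA be treated as the lower end of h(l-A). -/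
theorem mem_hFoldSumset_reflect {A B : Finset ℤ} {l : ℤ} (hB : ∀ b, b ∈ B ↔ l - b ∈ A) (h : ℕ) :
    ∀ s, s ∈ hFoldSumset h B ↔ h * l - s ∈ hFoldSumset h A := by
  induction h with
  | zero => simp [hFoldSumset_zero]
  | succ h ih =>
    intro s
    rw [mem_hFoldSumset_succ, mem_hFoldSumset_succ]
    constructor
    · rintro ⟨b, hb, hs⟩
      refine ⟨l - b, (hB b).1 hb, ?_⟩
      rw [ih] at hs
      convert hs using 1
      push_cast
      ring
    · rintro ⟨a, ha, hs⟩
      refine ⟨l - a, (hB _).2 (by simpa using ha), ?_⟩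
      rw [ih]
      convert hs using 1
      push_cast
      ring

/-- `A` is the interval `[0, l]` with the points `x`, `y`, `z` removed. -/
def IsPunctured (A : Finset ℤ) (l x y z : ℤ) : Prop :=
  ∀ a, a ∈ A ↔ 0 ≤ a ∧ a ≤ l ∧ a ≠ x ∧ a ≠ y ∧ a ≠ z

theorem IsPunctured.reflect {A : Finset ℤ} {l x y z : ℤ} (hA : IsPunctured A l x y z) :
    IsPunctured (A.image fun a => l - a) l (l - z) (l - y) (l - x) ∧
      ∀ b, b ∈ (A.image fun a => l - a) ↔ l - b ∈ A := by
  have h : ∀ b, b ∈ (A.image fun a => l - a) ↔ l - b ∈ A := by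
    intro b
    rw [Finset.mem_image]
    constructor
    · rintro ⟨a, ha, rfl⟩
      simpa using ha
    · exact fun h => ⟨_, h, by ring⟩
  refine ⟨fun b => ?_, h⟩
  rw [h, hA]
  omega

theorem IsPunctured.subset_Icc {A : Finset ℤ} {l x y z : ℤ} (hA : IsPunctured A l x y z) :
    A ⊆ Finset.Icc 0 l := fun a ha => Finset.mem_Icc.2 ⟨((hA a).1 ha).1, ((hA a).1 ha).2.1⟩

/-- For h = 2 and 6 ≤ n ≤ l, the four disjoint pairs {i, n-i}, 0 ≤ i ≤ 3, cannot all be hit by three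
removed points; n > l is symmetric. Larger h follow by adding 0 or l. -/
theorem IsPunctured.mem_of_middle {A : Finset ℤ} {l x y z : ℤ} (hA : IsPunctured A l x y z)
    (hl : 7 ≤ l) (h0 : 0 ∈ A) (hlA : l ∈ A) {h : ℕ} (hh : 2 ≤ h) :
    ∀ n : ℤ, 6 ≤ n → n ≤ h * l - 6 → n ∈ hFoldSumset h A := by
  have not_two : ∀ n : ℤ, n ∉ hFoldSumset 2 A → ∀ a, ¬ (a ∈ A ∧ n - a ∈ A) :=
    fun n hn a ha => hn (mem_hFoldSumset_two.2 ⟨a, ha⟩)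
  have h2 : ∀ n : ℤ, 6 ≤ n → n ≤ 2 * l - 6 → n ∈ hFoldSumset 2 A := by
    intro n hn6 hnl
    by_contra hn
    have key := not_two n hn
    rw [hA] at h0 hlA
    simp only [hA _] at key
    by_cases hnl' : n ≤ l
    · have k0 := key 0
      have k1 := key 1
      have k2 := key 2
      have k3 := key 3
      omega
    · have k0 := key l
      have k1 := key (l - 1)
      have k2 := key (l - 2)
      have k3 := key (l - 3)
      omega
  have hadd : ∀ h n, n - l ∈ hFoldSumset h A → n ∈ hFoldSumset (h + 1) A := fun h n hn =>
    mem_hFoldSumset_succ.2 ⟨l, hlA, hn⟩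
  have h3 : ∀ n : ℤ, 6 ≤ n → n ≤ 3 * l - 6 → n ∈ hFoldSumset 3 A := by
    intro n hn6 hnl
    by_cases c1 : n ≤ 2 * l - 6
    · exact hFoldSumset_subset_succ h0 2 (h2 n hn6 c1)
    by_cases c2 : l + 6 ≤ n
    · exact hadd 2 n (h2 _ (by omega) (by omega))
    by_contra hn
    have key := not_two n fun h => hn (hFoldSumset_subset_succ h0 2 h)
    have key' := not_two (n - l) fun h => hn (hadd 2 n h)
    rw [hA] at h0 hlA
    simp only [hA _] at key key'
    have k0 := key l
    have k1 := key (l - 1)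
    have k2 := key (l - 2)
    have k0' := key' 0
    have k1' := key' 1
    have k2' := key' 2
    -- The windows [6, 2l-6] and [l+6, 3l-6] leave a hole only for l ≤ 10. There, n or n-l is a sum
    -- of two elements.
    have : l ≤ 10 := by omega
    obtain ⟨t, rfl⟩ : ∃ t, n = l + t := ⟨n - l, by ring⟩
    clear key key' not_two h2 hadd hn
    interval_cases l <;> omega
  induction h, hh using Nat.le_induction with
  | base => exact h2
  | succ h hh ih =>
    intro n hn6 hnl
    rcases Nat.eq_or_lt_of_le hh with rfl | hh'
    · exact h3 n hn6 (by simpa using hnl)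
    · have e : ((h + 1 : ℕ) : ℤ) * l = h * l + l := by push_cast; ring
      rw [e] at hnl
      -- From h = 3 on, the window and its translate by l leave no hole.
      have : 3 * l ≤ h * l := by gcongr; exact_mod_cast hh'
      by_cases c : n ≤ h * l - 6
      · exact hFoldSumset_subset_succ h0 h (ih n hn6 c)
      · exact hadd h n (ih _ (by omega) (by omega))

/-- The number of elements of `[1, 5]` that `B` misses. -/
def lowGaps (B : Finset ℤ) : ℕ := (({1, 2, 3, 4, 5} : Finset ℤ).filter fun t => t ∉ B).card

theorem lowGaps_eq (B : Finset ℤ) : lowGaps B =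
    (if 1 ∉ B then 1 else 0) + ((if 2 ∉ B then 1 else 0) + ((if 3 ∉ B then 1 else 0) +
      ((if 4 ∉ B then 1 else 0) + (if 5 ∉ B then 1 else 0)))) := by
  rw [lowGaps, Finset.card_filter]
  simp

/-- The complement of hA in [0, hl] consists of the low gaps and the reflected ones, which are
disjoint because hl ≥ 14. -/
theorem IsPunctured.card_hFoldSumset {A : Finset ℤ} {l x y z : ℤ} (hA : IsPunctured A l x y z)
    (hl : 7 ≤ l) (h0 : 0 ∈ A) (hlA : l ∈ A) {h : ℕ} (hh : 2 ≤ h) :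
    ((hFoldSumset h A).card : ℤ) + lowGaps (hFoldSumset h A) +
      lowGaps (hFoldSumset h (A.image fun a => l - a)) = h * l + 1 := by
  have hhl : 14 ≤ h * l := by
    have : (2 : ℤ) ≤ h := by exact_mod_cast hh
    nlinarith
  set P := hFoldSumset h A with hP
  have hsub : P ⊆ Finset.Icc 0 (h * l) := hFoldSumset_subset_Icc hA.subset_Icc h
  have hrefl := mem_hFoldSumset_reflect hA.reflect.2 h
  have hrA : (0 : ℤ) ∈ A.image fun a => l - a := (hA.reflect.2 0).2 (by simpa using hlA)
  have hzero : ∀ B : Finset ℤ, 0 ∈ B → 0 ∈ hFoldSumset h B := fun B hB =>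
    hFoldSumset_mono hB (Nat.zero_le h) (by simp [hFoldSumset_zero])
  have hP0 : 0 ∈ P := hzero A h0
  have hPl : h * l ∈ P := by
    have := (hrefl 0).1 (hzero _ hrA)
    simpa using this
  set Q := hFoldSumset h (A.image fun a => l - a) with hQ
  have hcompl : Finset.Icc 0 (h * l) \ P =
      (({1, 2, 3, 4, 5} : Finset ℤ).filter fun t => t ∉ P) ∪
      ((({1, 2, 3, 4, 5} : Finset ℤ).filter fun t => t ∉ Q).image fun t => h * l - t) := by
    ext n
    have hmid := hA.mem_of_middle hl h0 hlA hh n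
    simp only [Finset.mem_sdiff, Finset.mem_Icc, Finset.mem_union, Finset.mem_filter,
      Finset.mem_image, Finset.mem_insert, Finset.mem_singleton]
    constructor
    · rintro ⟨⟨hn0, hn1⟩, hnP⟩
      have hn0' : n ≠ 0 := fun h => hnP (h ▸ hP0)
      have hn1' : n ≠ h * l := fun h => hnP (h ▸ hPl)
      have : ¬ (6 ≤ n ∧ n ≤ h * l - 6) := fun hn => hnP (hmid hn.1 hn.2)
      by_cases hn6 : n < 6
      · exact Or.inl ⟨by omega, hnP⟩
      · refine Or.inr ⟨h * l - n, ⟨by omega, ?_⟩, by ring⟩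
        rw [hrefl]
        simpa using hnP
    · rintro (⟨hn, hnP⟩ | ⟨t, ⟨ht, htQ⟩, rfl⟩)
      · exact ⟨by omega, hnP⟩
      · rw [hrefl] at htQ
        exact ⟨by omega, htQ⟩
  have hdisj : Disjoint (({1, 2, 3, 4, 5} : Finset ℤ).filter fun t => t ∉ P)
      ((({1, 2, 3, 4, 5} : Finset ℤ).filter fun t => t ∉ Q).image fun t => h * l - t) := by
    rw [Finset.disjoint_left]
    simp only [Finset.mem_filter, Finset.mem_image, Finset.mem_insert, Finset.mem_singleton]
    rintro n ⟨hn, -⟩ ⟨t, ⟨ht, -⟩, rfl⟩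
    omega
  have hcard := congrArg Finset.card hcompl
  rw [Finset.card_union_of_disjoint hdisj, Finset.card_sdiff_of_subset hsub, Int.card_Icc,
    Finset.card_image_of_injective _ sub_right_injective] at hcard
  have := Finset.card_le_card hsub
  rw [Int.card_Icc] at this
  simp only [lowGaps]
  omega

/-! ### Which of 1, …, 5 are sums -/

theorem mem_hFoldSumset_succ_of_nonneg {A : Finset ℤ} (hA : ∀ a ∈ A, 0 ≤ a) (h : ℕ) (s : ℤ) :
    s ∈ hFoldSumset (h + 1) A ↔ ∃ a, 0 ≤ a ∧ a ≤ s ∧ a ∈ A ∧ s - a ∈ hFoldSumset h A := by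
  have hnn : ∀ u ∈ hFoldSumset h A, 0 ≤ u := by
    intro u hu
    obtain ⟨l, -, rfl⟩ := mem_hFoldSumset.1 hu
    exact Finset.sum_nonneg fun a ha => mul_nonneg (by positivity) (hA a ha)
  rw [mem_hFoldSumset_succ]
  constructor
  · rintro ⟨a, ha, h⟩
    exact ⟨a, hA a ha, by linarith [hnn _ h], ha, h⟩
  · rintro ⟨a, -, -, ha, h⟩
    exact ⟨a, ha, h⟩

theorem mem_hFoldSumset_succ_small {A : Finset ℤ} (hA : ∀ a ∈ A, 0 ≤ a) (h0 : 0 ∈ A) (h : ℕ) :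
    (1 ∈ hFoldSumset (h + 1) A ↔ 1 ∈ hFoldSumset h A ∨ 1 ∈ A) ∧
    (2 ∈ hFoldSumset (h + 1) A ↔ 2 ∈ hFoldSumset h A ∨ 1 ∈ A ∧ 1 ∈ hFoldSumset h A ∨ 2 ∈ A) ∧
    (3 ∈ hFoldSumset (h + 1) A ↔ 3 ∈ hFoldSumset h A ∨ 1 ∈ A ∧ 2 ∈ hFoldSumset h A ∨
      2 ∈ A ∧ 1 ∈ hFoldSumset h A ∨ 3 ∈ A) ∧
    (4 ∈ hFoldSumset (h + 1) A ↔ 4 ∈ hFoldSumset h A ∨ 1 ∈ A ∧ 3 ∈ hFoldSumset h A ∨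
      2 ∈ A ∧ 2 ∈ hFoldSumset h A ∨ 3 ∈ A ∧ 1 ∈ hFoldSumset h A ∨ 4 ∈ A) ∧
    (5 ∈ hFoldSumset (h + 1) A ↔ 5 ∈ hFoldSumset h A ∨ 1 ∈ A ∧ 4 ∈ hFoldSumset h A ∨
      2 ∈ A ∧ 3 ∈ hFoldSumset h A ∨ 3 ∈ A ∧ 2 ∈ hFoldSumset h A ∨
      4 ∈ A ∧ 1 ∈ hFoldSumset h A ∨ 5 ∈ A) := by
  have hz : (0 : ℤ) ∈ hFoldSumset h A :=
    hFoldSumset_mono h0 (Nat.zero_le h) (by simp [hFoldSumset_zero])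
  simp only [mem_hFoldSumset_succ_of_nonneg hA]
  refine ⟨⟨?_, ?_⟩, ⟨?_, ?_⟩, ⟨?_, ?_⟩, ⟨?_, ?_⟩, ⟨?_, ?_⟩⟩
  · rintro ⟨a, ha0, ha1, ha, hs⟩
    interval_cases a <;> simp_all
  · rintro (h | h)
    · exact ⟨0, by simp [h0, h]⟩
    · exact ⟨1, by simp [hz, h]⟩
  · rintro ⟨a, ha0, ha1, ha, hs⟩
    interval_cases a <;> simp_all
  · rintro (h | h | h)
    · exact ⟨0, by simp [h0, h]⟩
    · exact ⟨1, by simp [h]⟩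
    · exact ⟨2, by simp [hz, h]⟩
  · rintro ⟨a, ha0, ha1, ha, hs⟩
    interval_cases a <;> simp_all
  · rintro (h | h | h | h)
    · exact ⟨0, by simp [h0, h]⟩
    · exact ⟨1, by simp [h]⟩
    · exact ⟨2, by simp [h]⟩
    · exact ⟨3, by simp [hz, h]⟩
  · rintro ⟨a, ha0, ha1, ha, hs⟩
    interval_cases a <;> simp_all
  · rintro (h | h | h | h | h)
    · exact ⟨0, by simp [h0, h]⟩
    · exact ⟨1, by simp [h]⟩
    · exact ⟨2, by simp [h]⟩
    · exact ⟨3, by simp [h]⟩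
    · exact ⟨4, by simp [hz, h]⟩
  · rintro ⟨a, ha0, ha1, ha, hs⟩
    interval_cases a <;> simp_all
  · rintro (h | h | h | h | h | h)
    · exact ⟨0, by simp [h0, h]⟩
    · exact ⟨1, by simp [h]⟩
    · exact ⟨2, by simp [h]⟩
    · exact ⟨3, by simp [h]⟩
    · exact ⟨4, by simp [h]⟩
    · exact ⟨5, by simp [hz, h]⟩

theorem mem_hFoldSumset_two_small {A : Finset ℤ} (hA : ∀ a ∈ A, 0 ≤ a) (h0 : 0 ∈ A) :
    (1 ∈ hFoldSumset 2 A ↔ 1 ∈ A) ∧ (2 ∈ hFoldSumset 2 A ↔ 1 ∈ A ∨ 2 ∈ A) ∧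
    (3 ∈ hFoldSumset 2 A ↔ 3 ∈ A ∨ 1 ∈ A ∧ 2 ∈ A) ∧
    (4 ∈ hFoldSumset 2 A ↔ 4 ∈ A ∨ 2 ∈ A ∨ 1 ∈ A ∧ 3 ∈ A) ∧
    (5 ∈ hFoldSumset 2 A ↔ 5 ∈ A ∨ 1 ∈ A ∧ 4 ∈ A ∨ 2 ∈ A ∧ 3 ∈ A) := by
  obtain ⟨e1, e2, e3, e4, e5⟩ := mem_hFoldSumset_succ_small hA h0 1
  rw [hFoldSumset_one] at e1 e2 e3 e4 e5
  rw [e1, e2, e3, e4, e5]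
  by_cases p1 : 1 ∈ A <;> by_cases p2 : 2 ∈ A <;> by_cases p3 : 3 ∈ A <;>
    by_cases p4 : 4 ∈ A <;> by_cases p5 : 5 ∈ A <;> simp [p1, p2, p3, p4, p5]

theorem mem_hFoldSumset_three_small {A : Finset ℤ} (hA : ∀ a ∈ A, 0 ≤ a) (h0 : 0 ∈ A) :
    (1 ∈ hFoldSumset 3 A ↔ 1 ∈ A) ∧ (2 ∈ hFoldSumset 3 A ↔ 1 ∈ A ∨ 2 ∈ A) ∧
    (3 ∈ hFoldSumset 3 A ↔ 3 ∈ A ∨ 1 ∈ A) ∧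
    (4 ∈ hFoldSumset 3 A ↔ 4 ∈ A ∨ 2 ∈ A ∨ 1 ∈ A ∧ 3 ∈ A) ∧
    (5 ∈ hFoldSumset 3 A ↔
      5 ∈ A ∨ 1 ∈ A ∧ (2 ∈ A ∨ 3 ∈ A ∨ 4 ∈ A) ∨ 2 ∈ A ∧ 3 ∈ A) := by
  obtain ⟨e1, e2, e3, e4, e5⟩ := mem_hFoldSumset_succ_small hA h0 2
  obtain ⟨d1, d2, d3, d4, d5⟩ := mem_hFoldSumset_two_small hA h0
  rw [e1, e2, e3, e4, e5, d1, d2, d3, d4, d5]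
  by_cases p1 : 1 ∈ A <;> by_cases p2 : 2 ∈ A <;> by_cases p3 : 3 ∈ A <;>
    by_cases p4 : 4 ∈ A <;> by_cases p5 : 5 ∈ A <;> simp [p1, p2, p3, p4, p5]

/-- Membership of 1, …, 5 no longer depends on h ≥ 4. Without `hs`, the number 5 could be available
only as 1+1+1+1+1, which needs h ≥ 5. -/
theorem mem_hFoldSumset_small {A : Finset ℤ} (hA : ∀ a ∈ A, 0 ≤ a) (h0 : 0 ∈ A)
    (hs : 2 ∈ A ∨ 3 ∈ A ∨ 4 ∈ A ∨ 5 ∈ A) {h : ℕ} (hh : 4 ≤ h) :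
    (1 ∈ hFoldSumset h A ↔ 1 ∈ A) ∧ (2 ∈ hFoldSumset h A ↔ 1 ∈ A ∨ 2 ∈ A) ∧
    (3 ∈ hFoldSumset h A ↔ 3 ∈ A ∨ 1 ∈ A) ∧ (4 ∈ hFoldSumset h A ↔ 4 ∈ A ∨ 2 ∈ A ∨ 1 ∈ A) ∧
    (5 ∈ hFoldSumset h A ↔ 5 ∈ A ∨ 1 ∈ A ∨ 2 ∈ A ∧ 3 ∈ A) := by
  induction h, hh using Nat.le_induction with
  | base =>
    obtain ⟨e1, e2, e3, e4, e5⟩ := mem_hFoldSumset_succ_small hA h0 3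
    obtain ⟨d1, d2, d3, d4, d5⟩ := mem_hFoldSumset_three_small hA h0
    rw [e1, e2, e3, e4, e5, d1, d2, d3, d4, d5]
    by_cases p1 : 1 ∈ A <;> by_cases p2 : 2 ∈ A <;> by_cases p3 : 3 ∈ A <;>
      by_cases p4 : 4 ∈ A <;> by_cases p5 : 5 ∈ A <;> simp [p1, p2, p3, p4, p5] at hs ⊢
  | succ h hh ih =>
    obtain ⟨e1, e2, e3, e4, e5⟩ := mem_hFoldSumset_succ_small hA h0 h
    obtain ⟨d1, d2, d3, d4, d5⟩ := ih
    rw [e1, e2, e3, e4, e5, d1, d2, d3, d4, d5]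
    by_cases p1 : 1 ∈ A <;> by_cases p2 : 2 ∈ A <;> by_cases p3 : 3 ∈ A <;>
      by_cases p4 : 4 ∈ A <;> by_cases p5 : 5 ∈ A <;> simp [p1, p2, p3, p4, p5]

/-! ### Gap counts in terms of the removed points -/

theorem IsPunctured.lowGaps_two {A : Finset ℤ} {l x y z : ℤ} (hA : IsPunctured A l x y z)
    (hl : 7 ≤ l) (h0 : 0 ∈ A) (hxy : x < y) (hyz : y < z) (hx : 1 ≤ x) :
    (x = 1 ∧ (y = 2 ∧ z ≤ 5 ∨ y = 3 ∧ z = 5) ∧ lowGaps (hFoldSumset 2 A) = 3) ∨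
    (x = 1 ∧ (y = 2 ∧ 5 < z ∨ y = 3 ∧ z ≠ 5) ∧ lowGaps (hFoldSumset 2 A) = 2) ∨
    (x = 1 ∧ 3 < y ∧ lowGaps (hFoldSumset 2 A) = 1) ∨
    (x = 2 ∧ y = 3 ∧ z = 4 ∧ lowGaps (hFoldSumset 2 A) = 2) ∨
    ((x = 2 ∧ y = 3 ∧ z ≠ 4 ∨ (x = 2 ∨ x = 3) ∧ y = 4 ∧ z = 5) ∧
      lowGaps (hFoldSumset 2 A) = 1) ∨
    (x ≠ 1 ∧ ¬ (x = 2 ∧ y = 3) ∧ ¬ ((x = 2 ∨ x = 3) ∧ y = 4 ∧ z = 5) ∧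
      lowGaps (hFoldSumset 2 A) = 0) := by
  have hnn : ∀ a ∈ A, 0 ≤ a := fun a ha => ((hA a).1 ha).1
  obtain ⟨e1, e2, e3, e4, e5⟩ := mem_hFoldSumset_two_small hnn h0
  have hG := lowGaps_eq (hFoldSumset 2 A)
  simp only [e1, e2, e3, e4, e5] at hG
  have hxc : x = 1 ∨ x = 2 ∨ x = 3 ∨ 4 ≤ x := by omega
  have hyc : y = 2 ∨ y = 3 ∨ y = 4 ∨ 5 ≤ y := by omega
  have hzc : z = 3 ∨ z = 4 ∨ z = 5 ∨ 6 ≤ z := by omega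
  rcases hxc with hx' | hx' | hx' | hx' <;> rcases hyc with hy' | hy' | hy' | hy' <;>
    rcases hzc with hz' | hz' | hz' | hz' <;> first | (exfalso; omega) | skip
  all_goals
    first | have b1 : 1 ∈ A := (hA 1).2 (by omega) |
      have b1 : 1 ∉ A := fun h => absurd ((hA 1).1 h) (by omega)
    first | have b2 : 2 ∈ A := (hA 2).2 (by omega) |
      have b2 : 2 ∉ A := fun h => absurd ((hA 2).1 h) (by omega)
    first | have b3 : 3 ∈ A := (hA 3).2 (by omega) |
      have b3 : 3 ∉ A := fun h => absurd ((hA 3).1 h) (by omega)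
    -- The case may leave membership of 4 or 5 undecided; the count then does not depend on it.
    first | have b4 : 4 ∈ A := (hA 4).2 (by omega) |
      have b4 : 4 ∉ A := fun h => absurd ((hA 4).1 h) (by omega) | skip
    first | have b5 : 5 ∈ A := (hA 5).2 (by omega) |
      have b5 : 5 ∉ A := fun h => absurd ((hA 5).1 h) (by omega) | skip
    clear hA hnn h0 e1 e2 e3 e4 e5
    simp [*] at hG
    omega

/-- Two removed points are coded by repeating the last one. This serves the case k+2 ∉ A, with
ambient interval [0, k+1]. -/
theorem IsPunctured.lowGaps_two_of_pair {A : Finset ℤ} {l x y : ℤ} (hA : IsPunctured A l x y y)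
    (hl : 7 ≤ l) (h0 : 0 ∈ A) (hxy : x < y) (hx : 1 ≤ x) :
    (x = 1 ∧ (y = 2 ∨ y = 3) ∧ lowGaps (hFoldSumset 2 A) = 2) ∨
    ((x = 1 ∧ 3 < y ∨ x = 2 ∧ y = 3) ∧ lowGaps (hFoldSumset 2 A) = 1) ∨
    (x ≠ 1 ∧ ¬ (x = 2 ∧ y = 3) ∧ lowGaps (hFoldSumset 2 A) = 0) := by
  have hnn : ∀ a ∈ A, 0 ≤ a := fun a ha => ((hA a).1 ha).1
  obtain ⟨e1, e2, e3, e4, e5⟩ := mem_hFoldSumset_two_small hnn h0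
  have hG := lowGaps_eq (hFoldSumset 2 A)
  simp only [e1, e2, e3, e4, e5] at hG
  have hxc : x = 1 ∨ x = 2 ∨ x = 3 ∨ 4 ≤ x := by omega
  have hyc : y = 2 ∨ y = 3 ∨ y = 4 ∨ 5 ≤ y := by omega
  rcases hxc with hx' | hx' | hx' | hx' <;> rcases hyc with hy' | hy' | hy' | hy' <;> first | (exfalso; omega) | skip
  all_goals
    first | have b1 : 1 ∈ A := (hA 1).2 (by omega) |
      have b1 : 1 ∉ A := fun h => absurd ((hA 1).1 h) (by omega)
    first | have b2 : 2 ∈ A := (hA 2).2 (by omega) |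
      have b2 : 2 ∉ A := fun h => absurd ((hA 2).1 h) (by omega)
    first | have b3 : 3 ∈ A := (hA 3).2 (by omega) |
      have b3 : 3 ∉ A := fun h => absurd ((hA 3).1 h) (by omega)
    first | have b4 : 4 ∈ A := (hA 4).2 (by omega) |
      have b4 : 4 ∉ A := fun h => absurd ((hA 4).1 h) (by omega) | skip
    first | have b5 : 5 ∈ A := (hA 5).2 (by omega) |
      have b5 : 5 ∉ A := fun h => absurd ((hA 5).1 h) (by omega) | skip
    clear hA hnn h0 e1 e2 e3 e4 e5
    simp [*] at hG
    omega

theorem IsPunctured.lowGaps_three {A : Finset ℤ} {l x y z : ℤ} (hA : IsPunctured A l x y z)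
    (hl : 7 ≤ l) (h0 : 0 ∈ A) (hxy : x < y) (hyz : y < z) (hx : 1 ≤ x) :
    (x = 1 ∧ (y = 2 ∧ z ≤ 5 ∨ y = 3 ∧ z = 5) ∧ lowGaps (hFoldSumset 3 A) = 3) ∨
    (x = 1 ∧ (y = 2 ∧ 5 < z ∨ y = 3 ∧ z ≠ 5) ∧ lowGaps (hFoldSumset 3 A) = 2) ∨
    (x = 1 ∧ 3 < y ∧ lowGaps (hFoldSumset 3 A) = 1) ∨
    (x = 2 ∧ y = 3 ∧ z = 4 ∧ lowGaps (hFoldSumset 3 A) = 1) ∨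
    (x ≠ 1 ∧ ¬ (x = 2 ∧ y = 3 ∧ z = 4) ∧ lowGaps (hFoldSumset 3 A) = 0) := by
  have hnn : ∀ a ∈ A, 0 ≤ a := fun a ha => ((hA a).1 ha).1
  obtain ⟨e1, e2, e3, e4, e5⟩ := mem_hFoldSumset_three_small hnn h0
  have hG := lowGaps_eq (hFoldSumset 3 A)
  simp only [e1, e2, e3, e4, e5] at hG
  have hxc : x = 1 ∨ x = 2 ∨ x = 3 ∨ 4 ≤ x := by omega
  have hyc : y = 2 ∨ y = 3 ∨ y = 4 ∨ 5 ≤ y := by omega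
  have hzc : z = 3 ∨ z = 4 ∨ z = 5 ∨ 6 ≤ z := by omega
  rcases hxc with hx' | hx' | hx' | hx' <;> rcases hyc with hy' | hy' | hy' | hy' <;>
    rcases hzc with hz' | hz' | hz' | hz' <;> first | (exfalso; omega) | skip
  all_goals
    first | have b1 : 1 ∈ A := (hA 1).2 (by omega) |
      have b1 : 1 ∉ A := fun h => absurd ((hA 1).1 h) (by omega)
    first | have b2 : 2 ∈ A := (hA 2).2 (by omega) |
      have b2 : 2 ∉ A := fun h => absurd ((hA 2).1 h) (by omega)
    first | have b3 : 3 ∈ A := (hA 3).2 (by omega) |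
      have b3 : 3 ∉ A := fun h => absurd ((hA 3).1 h) (by omega)
    first | have b4 : 4 ∈ A := (hA 4).2 (by omega) |
      have b4 : 4 ∉ A := fun h => absurd ((hA 4).1 h) (by omega) | skip
    first | have b5 : 5 ∈ A := (hA 5).2 (by omega) |
      have b5 : 5 ∉ A := fun h => absurd ((hA 5).1 h) (by omega) | skip
    clear hA hnn h0 e1 e2 e3 e4 e5
    simp [*] at hG
    omega

theorem IsPunctured.lowGaps_of_four_le {A : Finset ℤ} {l x y z : ℤ} (hA : IsPunctured A l x y z)
    (hl : 7 ≤ l) (h0 : 0 ∈ A) (hxy : x < y) (hyz : y < z) (hx : 1 ≤ x) {h : ℕ} (hh : 4 ≤ h) :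
    (x = 1 ∧ (y = 2 ∧ z ≤ 5 ∨ y = 3 ∧ z = 5) ∧ lowGaps (hFoldSumset h A) = 3) ∨
    (x = 1 ∧ (y = 2 ∧ 5 < z ∨ y = 3 ∧ z ≠ 5) ∧ lowGaps (hFoldSumset h A) = 2) ∨
    (x = 1 ∧ 3 < y ∧ lowGaps (hFoldSumset h A) = 1) ∨
    (x ≠ 1 ∧ lowGaps (hFoldSumset h A) = 0) := by
  have hnn : ∀ a ∈ A, 0 ≤ a := fun a ha => ((hA a).1 ha).1
  have hs : 2 ∈ A ∨ 3 ∈ A ∨ 4 ∈ A ∨ 5 ∈ A := by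
    simp only [hA _]
    omega
  obtain ⟨e1, e2, e3, e4, e5⟩ := mem_hFoldSumset_small hnn h0 hs hh
  have hG := lowGaps_eq (hFoldSumset h A)
  simp only [e1, e2, e3, e4, e5] at hG
  have hxc : x = 1 ∨ x = 2 ∨ x = 3 ∨ 4 ≤ x := by omega
  have hyc : y = 2 ∨ y = 3 ∨ y = 4 ∨ 5 ≤ y := by omega
  have hzc : z = 3 ∨ z = 4 ∨ z = 5 ∨ 6 ≤ z := by omega
  rcases hxc with hx' | hx' | hx' | hx' <;> rcases hyc with hy' | hy' | hy' | hy' <;>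
    rcases hzc with hz' | hz' | hz' | hz' <;> first | (exfalso; omega) | skip
  all_goals
    first | have b1 : 1 ∈ A := (hA 1).2 (by omega) |
      have b1 : 1 ∉ A := fun h => absurd ((hA 1).1 h) (by omega)
    first | have b2 : 2 ∈ A := (hA 2).2 (by omega) |
      have b2 : 2 ∉ A := fun h => absurd ((hA 2).1 h) (by omega)
    first | have b3 : 3 ∈ A := (hA 3).2 (by omega) |
      have b3 : 3 ∉ A := fun h => absurd ((hA 3).1 h) (by omega)
    first | have b4 : 4 ∈ A := (hA 4).2 (by omega) |
      have b4 : 4 ∉ A := fun h => absurd ((hA 4).1 h) (by omega) | skip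
    first | have b5 : 5 ∈ A := (hA 5).2 (by omega) |
      have b5 : 5 ∉ A := fun h => absurd ((hA 5).1 h) (by omega) | skip
    clear hA hnn h0 e1 e2 e3 e4 e5
    simp [*] at hG
    omega

/-! ### Cardinalities in terms of x, y, z -/

theorem hFoldSumset_card_le {A : Finset ℤ} {m : ℤ} (hm : 0 ≤ m) (hA : A ⊆ Finset.Icc 0 m) (h : ℕ) :
    ((hFoldSumset h A).card : ℤ) ≤ h * m + 1 := by
  have := Finset.card_le_card (hFoldSumset_subset_Icc hA h)
  rw [Int.card_Icc] at this
  have : 0 ≤ h * m := by positivity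
  omega

/-- In each third of [0, 3l], two summands are chosen from 0, 1, l-1, l so that the third runs
through three consecutive integers. At most two of these are removed, and if one falls outside [0,
l], another is 0, 1, l-1 or l. -/
theorem IsPunctured.hFoldSumset_three_eq {A : Finset ℤ} {l x y : ℤ} (hA : IsPunctured A l x y y)
    (hx : 2 ≤ x) (hxy : x < y) (hy : y ≤ l - 2) :
    hFoldSumset 3 A = Finset.Icc 0 (3 * l) := by
  refine Finset.Subset.antisymm (hFoldSumset_subset_Icc hA.subset_Icc 3) fun n hn => ?_
  rw [Finset.mem_Icc] at hn
  have h3 : ∀ a b, a ∈ A → b ∈ A → n - a - b ∈ A → n ∈ hFoldSumset 3 A := fun a b ha hb hc => by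
    rw [mem_hFoldSumset_succ]
    refine ⟨a, ha, ?_⟩
    rw [mem_hFoldSumset_two]
    exact ⟨b, hb, hc⟩
  by_contra hcon
  have key : ∀ a b, ¬ (a ∈ A ∧ b ∈ A ∧ n - a - b ∈ A) := fun a b h =>
    hcon (h3 a b h.1 h.2.1 h.2.2)
  simp only [hA _] at key
  clear hcon h3 hA
  by_cases c1 : n ≤ l
  · have k0 := key 0 0
    have k1 := key 0 1
    have k2 := key 1 1
    omega
  · by_cases c2 : n ≤ 2 * l
    · have k0 := key 0 l
      have k1 := key l 1
      have k2 := key 0 (l - 1)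
      omega
    · have k0 := key l l
      have k1 := key l (l - 1)
      have k2 := key (l - 1) (l - 1)
      omega

/-- The coordinate form of `IsBaseTriple`. -/
def IsBaseCoords (k x y z : ℤ) : Prop :=
  (x = 1 ∧ y = 2 ∧ z = 3) ∨ (x = k - 1 ∧ y = k ∧ z = k + 1) ∨
  (x = 1 ∧ y = 2 ∧ z = 4) ∨ (x = k - 2 ∧ y = k ∧ z = k + 1) ∨
  (x = 1 ∧ y = 2 ∧ z = k + 1) ∨ (x = 1 ∧ y = k ∧ z = k + 1) ∨
  (x = 1 ∧ y = 2 ∧ z = 5) ∨ (x = k - 3 ∧ y = k ∧ z = k + 1) ∨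
  (x = 1 ∧ y = 3 ∧ z = 5) ∨ (x = k - 3 ∧ y = k - 1 ∧ z = k + 1) ∨
  (x = 1 ∧ y = 3 ∧ z = k + 1) ∨ (x = 1 ∧ y = k - 1 ∧ z = k + 1)

theorem isBaseCoords_iff {k x y z : ℤ} (hk : 5 ≤ k) (hxy : x < y) (hyz : y < z) :
    IsBaseCoords k x y z ↔
      (x = 1 ∧ (y = 2 ∧ z ≤ 5 ∨ y = 3 ∧ z = 5)) ∨
      (z = k + 1 ∧ (y = k ∧ k - 3 ≤ x ∨ y = k - 1 ∧ x = k - 3)) ∨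
      (x = 1 ∧ z = k + 1 ∧ (y ≤ 3 ∨ k - 1 ≤ y)) := by
  constructor
  · rintro (h | h | h | h | h | h | h | h | h | h | h | h) <;> omega
  · unfold IsBaseCoords
    rintro (⟨rfl, ⟨rfl, hz⟩ | ⟨rfl, rfl⟩⟩ | ⟨rfl, ⟨rfl, hx⟩ | ⟨rfl, rfl⟩⟩ | ⟨rfl, rfl, hy | hy⟩)
    · obtain rfl | rfl | rfl : z = 3 ∨ z = 4 ∨ z = 5 := by omega
      all_goals simp
    · simp
    · obtain rfl | rfl | rfl : x = y - 1 ∨ x = y - 2 ∨ x = y - 3 := by omega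
      all_goals simp
    · simp
    · obtain rfl | rfl : y = 2 ∨ y = 3 := by omega
      all_goals simp
    · obtain rfl | rfl : y = k - 1 ∨ y = k := by omega
      all_goals simp

theorem card_hFoldSumset_two_iff {A : Finset ℤ} {k x y z : ℤ} (hk : 6 ≤ k)
    (hx : 1 ≤ x) (hxy : x < y) (hyz : y < z) (hz : z ≤ k + 2)
    (hA : IsPunctured A (k + 2) x y z) :
    ((hFoldSumset 2 A).card : ℤ) = 2 * k + 2 ↔
      (x = 2 ∧ y = 3 ∧ z = k + 2) ∨ (x = k - 2 ∧ y = k - 1 ∧ z = k + 2) ∨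
      (x = 1 ∧ 4 ≤ y ∧ y ≤ k - 1 ∧ z = k + 2) ∨ (2 ≤ x ∧ x ≤ k - 3 ∧ y = k ∧ z = k + 2) ∨
      IsBaseCoords k x y z := by
  have h0 : 0 ∈ A := (hA 0).2 (by omega)
  by_cases hz1 : z ≤ k + 1
  · have hlA : k + 2 ∈ A := (hA _).2 (by omega)
    have hcard := hA.card_hFoldSumset (by omega) h0 hlA le_rfl
    have hL := hA.lowGaps_two (by omega) h0 hxy hyz hx
    have hR := hA.reflect.1.lowGaps_two (by omega) ((hA.reflect.2 0).2 (by simpa using hlA))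
      (by omega) (by omega) (by omega)
    generalize lowGaps _ = L at hcard hL
    generalize lowGaps _ = R at hcard hR
    generalize Finset.card _ = c at hcard ⊢
    clear hA h0 hlA
    push_cast at hcard
    -- 2(k+2)+1 - (2k+2) = 3.
    have hc : c = 2 * k + 2 ↔ L + R = 3 := by omega
    rw [hc, isBaseCoords_iff (by omega) hxy hyz]
    clear hc hcard
    constructor
    · intro hLR
      refine Or.inr (Or.inr (Or.inr (Or.inr ?_)))
      rcases hL with hL | hL | hL | hL | hL | hL <;> rcases hR with hR | hR | hR | hR | hR | hR <;>
        first | (exfalso; omega) | omega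
    · rintro (⟨-, -, h⟩ | ⟨-, -, h⟩ | ⟨-, -, -, h⟩ | ⟨-, -, -, h⟩ |
        ⟨h, h' | h'⟩ | ⟨h, h' | h'⟩ | ⟨h, h', h'' | h''⟩)
      · exact absurd hz1 (by rw [h]; norm_num)
      · exact absurd hz1 (by rw [h]; norm_num)
      · exact absurd hz1 (by rw [h]; norm_num)
      · exact absurd hz1 (by rw [h]; norm_num)
      all_goals
        rcases hL with hL | hL | hL | hL | hL | hL <;> try (exfalso; omega)
        all_goals rcases hR with hR | hR | hR | hR | hR | hR <;> omega
  · obtain rfl : z = k + 2 := by omega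
    by_cases hy : y ≤ k
    · have hA' : IsPunctured A (k + 1) x y y := fun a => by rw [hA]; omega
      have hlA : k + 1 ∈ A := (hA' _).2 (by omega)
      have hcard := hA'.card_hFoldSumset (by omega) h0 hlA le_rfl
      -- Reflection puts the repeated point first; it is recoded to come last.
      have hA'' : IsPunctured (A.image fun a => k + 1 - a) (k + 1) (k + 1 - y) (k + 1 - x)
          (k + 1 - x) := fun a => by rw [hA'.reflect.1]; omega
      have hL := hA'.lowGaps_two_of_pair (by omega) h0 hxy hx
      have hR := hA''.lowGaps_two_of_pair (by omega)
        ((hA'.reflect.2 0).2 (by simpa using hlA)) (by omega) (by omega)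
      generalize lowGaps _ = L at hcard hL
      generalize lowGaps _ = R at hcard hR
      generalize Finset.card _ = c at hcard ⊢
      clear hA h0 hlA hA' hA''
      push_cast at hcard
      have hc : c = 2 * k + 2 ↔ L + R = 1 := by omega
      have hB : ¬ IsBaseCoords k x y (k + 2) := by
        rw [isBaseCoords_iff (by omega) hxy hyz]
        omega
      simp only [hc, hB, or_false, and_true]
      clear hc hB hcard
      constructor
      · intro hLR
        rcases hL with hL | hL | hL <;> rcases hR with hR | hR | hR <;> omega
      · rintro (h | h | h | h) <;> rcases hL with hL | hL | hL <;>
          rcases hR with hR | hR | hR <;> omega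
    -- Here k+1 and k+2 are both removed, so |2A| ≤ 2k+1.
    · have hsub : A ⊆ Finset.Icc 0 k := fun a ha => by
        rw [hA] at ha
        rw [Finset.mem_Icc]
        omega
      have := hFoldSumset_card_le (by omega) hsub 2
      rw [isBaseCoords_iff (by omega) hxy hyz]
      push_cast at this
      omega

theorem card_hFoldSumset_three_iff {A : Finset ℤ} {k x y z : ℤ} (hk : 5 ≤ k)
    (hx : 1 ≤ x) (hxy : x < y) (hyz : y < z) (hz : z ≤ k + 2)
    (hA : IsPunctured A (k + 2) x y z) :
    ((hFoldSumset 3 A).card : ℤ) = 3 * k + 4 ↔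
      IsBaseCoords k x y z ∨ (2 ≤ x ∧ y ≤ k - 1 ∧ z = k + 2) := by
  have h0 : 0 ∈ A := (hA 0).2 (by omega)
  by_cases hz1 : z ≤ k + 1
  · have hlA : k + 2 ∈ A := (hA _).2 (by omega)
    have hcard := hA.card_hFoldSumset (by omega) h0 hlA (by norm_num : 2 ≤ 3)
    have hL := hA.lowGaps_three (by omega) h0 hxy hyz hx
    have hR := hA.reflect.1.lowGaps_three (by omega) ((hA.reflect.2 0).2 (by simpa using hlA))
      (by omega) (by omega) (by omega)
    generalize lowGaps _ = L at hcard hL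
    generalize lowGaps _ = R at hcard hR
    generalize Finset.card _ = c at hcard ⊢
    clear hA h0 hlA
    push_cast at hcard
    rw [isBaseCoords_iff (by omega) hxy hyz]
    rcases hL with hL | hL | hL | hL | hL <;> rcases hR with hR | hR | hR | hR | hR <;> omega
  · obtain rfl : z = k + 2 := by omega
    by_cases hy : y ≤ k
    · have hA' : IsPunctured A (k + 1) x y y := fun a => by rw [hA]; omega
      have hsub := hFoldSumset_subset_Icc hA'.subset_Icc 3
      -- 3k+4 is the size of the whole interval [0, 3(k+1)].
      have hiff : ((hFoldSumset 3 A).card : ℤ) = 3 * k + 4 ↔ 2 ≤ x ∧ y ≤ k - 1 := by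
        constructor
        · intro hc
          have heq := Finset.eq_of_subset_of_card_le hsub (by
            rw [Int.card_Icc]
            push_cast
            omega)
          have h1 : 1 ∈ hFoldSumset 3 A := by
            rw [heq, Finset.mem_Icc]
            constructor
            · norm_num
            · push_cast
              omega
          rw [(mem_hFoldSumset_three_small (fun a ha => ((hA a).1 ha).1) h0).1, hA'] at h1
          have hr := hA'.reflect
          have h2 : 1 ∈ hFoldSumset 3 (A.image fun a => k + 1 - a) := by
            rw [mem_hFoldSumset_reflect hr.2, heq, Finset.mem_Icc]
            push_cast
            omega
          have hr0 : 0 ∈ A.image fun a => k + 1 - a := (hr.2 0).2 ((hA' _).2 (by omega))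
          rw [(mem_hFoldSumset_three_small (fun a ha => ((hr.1 a).1 ha).1) hr0).1, hr.2, hA'] at h2
          omega
        · rintro ⟨h1, h2⟩
          rw [hA'.hFoldSumset_three_eq h1 hxy (by omega), Int.card_Icc]
          omega
      rw [hiff]
      rw [isBaseCoords_iff (by omega) hxy hyz]
      omega
    · have hsub : A ⊆ Finset.Icc 0 k := fun a ha => by
        rw [hA] at ha
        rw [Finset.mem_Icc]
        omega
      have := hFoldSumset_card_le (by omega) hsub 3
      rw [isBaseCoords_iff (by omega) hxy hyz]
      push_cast at this
      omega

/-- Excludes z = k+2 from the later counts: h(k+1)+1 is below hk+2h-2 for h ≥ 4, and below hk+2h-1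
already for h = 3. -/
theorem hFoldSumset_card_le_of_mem {A : Finset ℤ} {k x y : ℤ} (hk : 5 ≤ k)
    (hA : IsPunctured A (k + 2) x y (k + 2)) (h : ℕ) :
    ((hFoldSumset h A).card : ℤ) ≤ h * k + h + 1 := by
  have hsub : A ⊆ Finset.Icc 0 (k + 1) := fun a ha => by
    rw [hA] at ha
    rw [Finset.mem_Icc]
    omega
  have := hFoldSumset_card_le (by omega) hsub h
  linarith

theorem card_hFoldSumset_add_gaps {A : Finset ℤ} {k x y z : ℤ} (hk : 5 ≤ k)
    (hx : 1 ≤ x) (hxy : x < y) (hyz : y < z) (hz : z ≤ k + 1)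
    (hA : IsPunctured A (k + 2) x y z) {h : ℕ} (hh : 4 ≤ h) :
    ∃ L R : ℕ, ((hFoldSumset h A).card : ℤ) + L + R = h * k + 2 * h + 1 ∧
      ((x = 1 ∧ (y = 2 ∧ z ≤ 5 ∨ y = 3 ∧ z = 5) ∧ L = 3) ∨
        (x = 1 ∧ (y = 2 ∧ 5 < z ∨ y = 3 ∧ z ≠ 5) ∧ L = 2) ∨
        (x = 1 ∧ 3 < y ∧ L = 1) ∨ (x ≠ 1 ∧ L = 0)) ∧
      ((z = k + 1 ∧ (y = k ∧ k - 3 ≤ x ∨ y = k - 1 ∧ x = k - 3) ∧ R = 3) ∨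
        (z = k + 1 ∧ (y = k ∧ x < k - 3 ∨ y = k - 1 ∧ x ≠ k - 3) ∧ R = 2) ∨
        (z = k + 1 ∧ y < k - 1 ∧ R = 1) ∨ (z ≠ k + 1 ∧ R = 0)) := by
  have h0 : 0 ∈ A := (hA 0).2 (by omega)
  have hlA : k + 2 ∈ A := (hA _).2 (by omega)
  have hcard := hA.card_hFoldSumset (by omega) h0 hlA (by omega : 2 ≤ h)
  have hL := hA.lowGaps_of_four_le (by omega) h0 hxy hyz hx hh
  have hR := hA.reflect.1.lowGaps_of_four_le (by omega)
    ((hA.reflect.2 0).2 (by simpa using hlA)) (by omega) (by omega) (by omega) hh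
  refine ⟨_, _, by rw [hcard]; ring, hL, ?_⟩
  omega

theorem card_hFoldSumset_iff_three_gaps {A : Finset ℤ} {k x y z : ℤ} (hk : 5 ≤ k)
    (hx : 1 ≤ x) (hxy : x < y) (hyz : y < z) (hz : z ≤ k + 2)
    (hA : IsPunctured A (k + 2) x y z) {h : ℕ} (hh : 4 ≤ h) :
    ((hFoldSumset h A).card : ℤ) = h * k + 2 * h - 2 ↔ IsBaseCoords k x y z := by
  rw [isBaseCoords_iff (by omega) hxy hyz]
  by_cases hz1 : z ≤ k + 1
  · obtain ⟨L, R, hc, hL, hR⟩ := card_hFoldSumset_add_gaps hk hx hxy hyz hz1 hA hh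
    rcases hL with hL | hL | hL | hL <;> rcases hR with hR | hR | hR | hR <;> omega
  · obtain rfl : z = k + 2 := by omega
    have := hFoldSumset_card_le_of_mem hk hA h
    omega

/-- At h = 3 the gap table differs from the one for h ≥ 4 only at {2,3,4} and its mirror image,
which have one gap in all and so do not affect this count. -/
theorem card_hFoldSumset_iff_two_gaps {A : Finset ℤ} {k x y z : ℤ} {h : ℕ}
    (hk : 4 ≤ h ∧ 5 ≤ k ∨ 3 ≤ h ∧ 6 ≤ k)
    (hx : 1 ≤ x) (hxy : x < y) (hyz : y < z) (hz : z ≤ k + 2)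
    (hA : IsPunctured A (k + 2) x y z) :
    ((hFoldSumset h A).card : ℤ) = h * k + 2 * h - 1 ↔
      (x = 1 ∧ z ≤ k ∧ (y = 2 ∧ 6 ≤ z ∨ y = 3 ∧ z ≠ 5)) ∨
      (2 ≤ x ∧ z = k + 1 ∧ (y = k ∧ x ≤ k - 4 ∨ y = k - 1 ∧ x ≠ k - 3)) ∨
      (x = 1 ∧ 4 ≤ y ∧ y ≤ k - 2 ∧ z = k + 1) := by
  by_cases hz1 : z ≤ k + 1
  · by_cases hh : 4 ≤ h
    · obtain ⟨L, R, hc, hL, hR⟩ := card_hFoldSumset_add_gaps (by omega) hx hxy hyz hz1 hA hh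
      rcases hL with hL | hL | hL | hL <;> rcases hR with hR | hR | hR | hR <;> omega
    · obtain rfl : h = 3 := by omega
      have h0 : 0 ∈ A := (hA 0).2 (by omega)
      have hlA : k + 2 ∈ A := (hA _).2 (by omega)
      have hcard := hA.card_hFoldSumset (by omega) h0 hlA (by norm_num : 2 ≤ 3)
      have hL := hA.lowGaps_three (by omega) h0 hxy hyz hx
      have hR := hA.reflect.1.lowGaps_three (by omega) ((hA.reflect.2 0).2 (by simpa using hlA))
        (by omega) (by omega) (by omega)
      generalize lowGaps _ = L at hcard hL
      generalize lowGaps _ = R at hcard hR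
      generalize Finset.card _ = c at hcard ⊢
      clear hA h0 hlA
      push_cast at hcard ⊢
      rcases hL with hL | hL | hL | hL | hL <;> rcases hR with hR | hR | hR | hR | hR <;> omega
  · obtain rfl : z = k + 2 := by omega
    have := hFoldSumset_card_le_of_mem (by omega) hA h
    omega

theorem card_hFoldSumset_iff_one_gap {A : Finset ℤ} {k x y z : ℤ} (hk : 5 ≤ k)
    (hx : 1 ≤ x) (hxy : x < y) (hyz : y < z) (hz : z ≤ k + 2)
    (hA : IsPunctured A (k + 2) x y z) {h : ℕ} (hh : 4 ≤ h) :
    ((hFoldSumset h A).card : ℤ) = h * k + 2 * h ↔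
      (2 ≤ x ∧ y ≤ k - 2 ∧ z = k + 1) ∨ (x = 1 ∧ 4 ≤ y ∧ z ≤ k) := by
  by_cases hz1 : z ≤ k + 1
  · obtain ⟨L, R, hc, hL, hR⟩ := card_hFoldSumset_add_gaps hk hx hxy hyz hz1 hA hh
    rcases hL with hL | hL | hL | hL <;> rcases hR with hR | hR | hR | hR <;> omega
  · obtain rfl : z = k + 2 := by omega
    have := hFoldSumset_card_le_of_mem hk hA h
    omega

theorem card_hFoldSumset_iff_no_gap {A : Finset ℤ} {k x y z : ℤ} (hk : 5 ≤ k)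
    (hx : 1 ≤ x) (hxy : x < y) (hyz : y < z) (hz : z ≤ k + 2)
    (hA : IsPunctured A (k + 2) x y z) {h : ℕ} (hh : 4 ≤ h) :
    ((hFoldSumset h A).card : ℤ) = h * k + 2 * h + 1 ↔ 2 ≤ x ∧ z ≤ k := by
  by_cases hz1 : z ≤ k + 1
  · obtain ⟨L, R, hc, hL, hR⟩ := card_hFoldSumset_add_gaps hk hx hxy hyz hz1 hA hh
    omega
  · obtain rfl : z = k + 2 := by omega
    have := hFoldSumset_card_le_of_mem hk hA h
    omega

/-! ### From coordinates to sets of removed points -/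

theorem exists_sorted_triple {s : Finset ℤ} (hs : s.card = 3) :
    ∃ x y z, x < y ∧ y < z ∧ s = {x, y, z} := by
  obtain ⟨a, b, c, hab, hac, hbc, rfl⟩ := Finset.card_eq_three.1 hs
  rcases lt_or_gt_of_ne hab with h1 | h1 <;> rcases lt_or_gt_of_ne hac with h2 | h2 <;>
    rcases lt_or_gt_of_ne hbc with h3 | h3
  · exact ⟨a, b, c, h1, h3, rfl⟩
  · exact ⟨a, c, b, h2, h3, by ext t; simp; tauto⟩
  · omega
  · exact ⟨c, a, b, h2, h1, by ext t; simp; tauto⟩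
  · exact ⟨b, a, c, h1, h2, by ext t; simp; tauto⟩
  · omega
  · exact ⟨b, c, a, h3, h2, by ext t; simp; tauto⟩
  · exact ⟨c, b, a, h3, h1, by ext t; simp; tauto⟩

theorem triple_eq_iff {x y z a b c : ℤ} (hxy : x < y) (hyz : y < z) (hab : a < b) (hbc : b < c) :
    ({x, y, z} : Finset ℤ) = {a, b, c} ↔ x = a ∧ y = b ∧ z = c := by
  constructor
  · intro h
    have hm : ∀ t, (t = x ∨ t = y ∨ t = z) ↔ (t = a ∨ t = b ∨ t = c) := fun t => by
      simpa using congrArg (t ∈ ·) h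
    have h1 := (hm x).1 (by simp)
    have h2 := (hm y).1 (by simp)
    have h3 := (hm z).1 (by simp)
    have h4 := (hm a).2 (by simp)
    have h6 := (hm c).2 (by simp)
    omega
  · rintro ⟨rfl, rfl, rfl⟩
    rfl

/-- T is not assumed to lie in I or to have three elements, but {x,y,z} ⊆ T and |T| ≤ 3 force
equality. -/
theorem exists_sdiff_iff {A I : Finset ℤ} {x y z : ℤ} (hxy : x < y) (hyz : y < z)
    (hI : {x, y, z} ⊆ I) (hA : A = I \ {x, y, z}) {P : Finset ℤ → Prop}
    (hP : ∀ T, P T → T.card ≤ 3) :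
    (∃ T, A = I \ T ∧ P T) ↔ P {x, y, z} := by
  constructor
  · rintro ⟨T, hT, h⟩
    have hsub : ({x, y, z} : Finset ℤ) ⊆ T := by
      intro t ht
      by_contra htT
      have h1 : t ∈ A := hT ▸ Finset.mem_sdiff.2 ⟨hI ht, htT⟩
      rw [hA] at h1
      exact (Finset.mem_sdiff.1 h1).2 ht
    have hc : ({x, y, z} : Finset ℤ).card = 3 :=
      Finset.card_eq_three.2 ⟨x, y, z, by omega, by omega, by omega, rfl⟩
    rwa [Finset.eq_of_subset_of_card_le hsub (by rw [hc]; exact hP T h)]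
  · exact fun h => ⟨_, hA, h⟩

theorem isBaseTriple_iff {k x y z : ℤ} (hk : 5 ≤ k) (hxy : x < y) (hyz : y < z) :
    IsBaseTriple k {x, y, z} ↔ IsBaseCoords k x y z := by
  have h := fun a b c (hab : a < b) (hbc : b < c) => triple_eq_iff hxy hyz hab hbc
  unfold IsBaseTriple IsBaseCoords
  rw [h 1 2 3 (by omega) (by omega), h (k - 1) k (k + 1) (by omega) (by omega),
    h 1 2 4 (by omega) (by omega), h (k - 2) k (k + 1) (by omega) (by omega),
    h 1 2 (k + 1) (by omega) (by omega), h 1 k (k + 1) (by omega) (by omega),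
    h 1 2 5 (by omega) (by omega), h (k - 3) k (k + 1) (by omega) (by omega),
    h 1 3 5 (by omega) (by omega), h (k - 3) (k - 1) (k + 1) (by omega) (by omega),
    h 1 3 (k + 1) (by omega) (by omega), h 1 (k - 1) (k + 1) (by omega) (by omega)]

theorem IsBaseTriple.card_le {k : ℤ} {T : Finset ℤ} (h : IsBaseTriple k T) : T.card ≤ 3 := by
  rcases h with rfl | rfl | rfl | rfl | rfl | rfl | rfl | rfl | rfl | rfl | rfl | rfl <;>
    exact Finset.card_le_three

/-! ### The classification -/

theorem theorem1p7 (h k : ℕ) (hh : 2 ≤ h) (hk : 5 ≤ k)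
    (A : Finset ℤ) (hne : A.Nonempty) (hcard : A.card = k)
    (hmin : A.min' hne = 0) (hd : diffGcd A hne = 1) :
    -- (1)
    (6 ≤ k → (((hFoldSumset 2 A).card : ℤ) = 2 * k + 2 ↔
      ∃ T : Finset ℤ, A = Finset.Icc (0 : ℤ) (k + 2) \ T ∧
        (T = {2, 3, (k : ℤ) + 2} ∨ T = {(k : ℤ) - 2, (k : ℤ) - 1, (k : ℤ) + 2} ∨
         (∃ i : ℤ, 4 ≤ i ∧ i ≤ k - 1 ∧ T = {1, i, (k : ℤ) + 2}) ∨
         (∃ i : ℤ, 2 ≤ i ∧ i ≤ k - 3 ∧ T = {i, (k : ℤ), (k : ℤ) + 2}) ∨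
         IsBaseTriple k T))) ∧
    -- (2)
    (((hFoldSumset 3 A).card : ℤ) = 3 * k + 4 ↔
      ∃ T : Finset ℤ, A = Finset.Icc (0 : ℤ) (k + 2) \ T ∧
        (IsBaseTriple k T ∨
         (∃ i j : ℤ, 2 ≤ i ∧ i < j ∧ j ≤ k - 1 ∧ T = {i, j, (k : ℤ) + 2}))) ∧
    -- (3)
    (4 ≤ h → (((hFoldSumset h A).card : ℤ) = h * k + 2 * h - 2 ↔
      ∃ T : Finset ℤ, A = Finset.Icc (0 : ℤ) (k + 2) \ T ∧ IsBaseTriple k T)) ∧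
    -- (4)
    ((4 ≤ h ∧ 5 ≤ k) ∨ (3 ≤ h ∧ 6 ≤ k) →
      (((hFoldSumset h A).card : ℤ) = h * k + 2 * h - 1 ↔
      ∃ T : Finset ℤ, A = Finset.Icc (0 : ℤ) (k + 2) \ T ∧
        (T = {1, 3, 4} ∨ T = {(k : ℤ) - 2, (k : ℤ) - 1, (k : ℤ) + 1} ∨
         (∃ i : ℤ, 6 ≤ i ∧ i ≤ k ∧ T = {1, 2, i}) ∨
         (∃ i : ℤ, 2 ≤ i ∧ i ≤ k - 4 ∧ T = {i, (k : ℤ), (k : ℤ) + 1}) ∨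
         (∃ i : ℤ, 6 ≤ i ∧ i ≤ k ∧ T = {1, 3, i}) ∨
         (∃ i : ℤ, 2 ≤ i ∧ i ≤ k - 4 ∧ T = {i, (k : ℤ) - 1, (k : ℤ) + 1}) ∨
         (∃ i : ℤ, 4 ≤ i ∧ i ≤ k - 2 ∧ T = {1, i, (k : ℤ) + 1})))) ∧
    -- (5)
    ((4 ≤ h ∧ 6 ≤ k) ∨ (5 ≤ h ∧ 5 ≤ k) →
      (((hFoldSumset h A).card : ℤ) = h * k + 2 * h ↔
      ∃ T : Finset ℤ, A = Finset.Icc (0 : ℤ) (k + 2) \ T ∧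
        (T = {2, 3, (k : ℤ) + 1} ∨ T = {1, (k : ℤ) - 1, (k : ℤ)} ∨
         (∃ i : ℤ, 3 ≤ i ∧ i ≤ k - 3 ∧ T = {i, i + 1, (k : ℤ) + 1}) ∨
         (∃ i : ℤ, 4 ≤ i ∧ i ≤ k - 2 ∧ T = {1, i, i + 1}) ∨
         (∃ i : ℤ, 2 ≤ i ∧ i ≤ k - 4 ∧ T = {i, i + 2, (k : ℤ) + 1}) ∨
         (∃ i : ℤ, 4 ≤ i ∧ i ≤ k - 2 ∧ T = {1, i, i + 2}) ∨
         (∃ i j : ℤ, 4 ≤ i ∧ i ≤ j - 3 ∧ j - 3 ≤ k - 3 ∧ T = {1, i, j}) ∨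
         (∃ i j : ℤ, 2 ≤ i ∧ i ≤ j - 3 ∧ j - 3 ≤ k - 5 ∧ T = {i, j, (k : ℤ) + 1})))) ∧
    -- (6)
    ((5 ≤ h ∧ 6 ≤ k) ∨ (6 ≤ h ∧ 5 ≤ k) →
      (((hFoldSumset h A).card : ℤ) = h * k + 2 * h + 1 ↔
      ∃ x y z : ℤ, 2 ≤ x ∧ x < y ∧ y < z ∧ z ≤ k ∧
        A = Finset.Icc (0 : ℤ) (k + 2) \ {x, y, z})) := by
  have hk' : (5 : ℤ) ≤ k := by exact_mod_cast hk
  have h0 : 0 ∈ A := hmin ▸ A.min'_mem hne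
  have hnn : ∀ a ∈ A, 0 ≤ a := fun a ha => hmin ▸ A.min'_le a ha
  by_cases hlong : ∀ a ∈ A, a ≤ k + 2
  · have hsub : A ⊆ Finset.Icc (0 : ℤ) (k + 2) := fun a ha =>
      Finset.mem_Icc.2 ⟨hnn a ha, hlong a ha⟩
    obtain ⟨x, y, z, hxy, hyz, hT⟩ := exists_sorted_triple
      (s := Finset.Icc (0 : ℤ) (k + 2) \ A) (by
        rw [Finset.card_sdiff_of_subset hsub, Int.card_Icc, hcard]
        omega)
    have hI : ({x, y, z} : Finset ℤ) ⊆ Finset.Icc (0 : ℤ) (k + 2) :=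
      hT ▸ Finset.sdiff_subset
    have hA : A = Finset.Icc (0 : ℤ) (k + 2) \ {x, y, z} := by
      rw [← hT, Finset.sdiff_sdiff_eq_self hsub]
    have hP : IsPunctured A (k + 2) x y z := fun a => by
      rw [hA]
      simp
      tauto
    have hx0 := Finset.mem_Icc.1 (hI (by simp : x ∈ ({x, y, z} : Finset ℤ)))
    have hz0 := Finset.mem_Icc.1 (hI (by simp : z ∈ ({x, y, z} : Finset ℤ)))
    have hx : 1 ≤ x := by
      have := ((hP 0).1 h0).2.2.1
      omega
    have hz := hz0.2
    have htri := fun a b c (hab : a < b) (hbc : b < c) => triple_eq_iff hxy hyz hab hbc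
    have hbase := isBaseTriple_iff hk' hxy hyz
    have hex := fun P => exists_sdiff_iff (P := P) hxy hyz hI hA
    refine ⟨fun hk6 => ?_, ?_, fun hh4 => ?_, fun hhk => ?_, fun hhk => ?_, fun hhk => ?_⟩
    · rw [card_hFoldSumset_two_iff (by omega) hx hxy hyz hz hP, hex, hbase,
        htri 2 3 _ (by omega) (by omega), htri (k - 2) (k - 1) _ (by omega) (by omega)]
      · refine or_congr_right (or_congr_right (or_congr ?_ (or_congr ?_ Iff.rfl)))
        · constructor
          · exact fun hl => ⟨y, hl.2.1, hl.2.2.1,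
              (htri _ _ _ (by omega) (by omega)).2 ⟨hl.1, rfl, hl.2.2.2⟩⟩
          · rintro ⟨i, h1, h2, h3⟩
            rw [htri _ _ _ (by omega) (by omega)] at h3
            omega
        · constructor
          · exact fun hl => ⟨x, hl.1, hl.2.1,
              (htri _ _ _ (by omega) (by omega)).2 ⟨rfl, hl.2.2.1, hl.2.2.2⟩⟩
          · rintro ⟨i, h1, h2, h3⟩
            rw [htri _ _ _ (by omega) (by omega)] at h3
            omega
      · rintro T (rfl | rfl | ⟨i, -, -, rfl⟩ | ⟨i, -, -, rfl⟩ | hT)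
        · exact Finset.card_le_three
        · exact Finset.card_le_three
        · exact Finset.card_le_three
        · exact Finset.card_le_three
        · exact hT.card_le
    · rw [card_hFoldSumset_three_iff hk' hx hxy hyz hz hP, hex, hbase]
      · refine or_congr_right ?_
        constructor
        · exact fun hl => ⟨x, y, hl.1, hxy, hl.2.1,
            (htri _ _ _ (by omega) (by omega)).2 ⟨rfl, rfl, hl.2.2⟩⟩
        · rintro ⟨i, j, h1, h2, h3, h4⟩
          rw [htri _ _ _ (by omega) (by omega)] at h4
          omega
      · rintro T (hT | ⟨i, j, -, -, -, rfl⟩)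
        · exact hT.card_le
        · exact Finset.card_le_three
    · rw [card_hFoldSumset_iff_three_gaps hk' hx hxy hyz hz hP hh4, hex, hbase]
      exact fun T hT => hT.card_le
    · rw [card_hFoldSumset_iff_two_gaps (by omega) hx hxy hyz hz hP, hex]
      · constructor
        · rintro (⟨hx1, hzk, ⟨hy, hz6⟩ | ⟨hy, hz5⟩⟩ | ⟨hx2, hzk, ⟨hy, hxk⟩ | ⟨hy, hxk⟩⟩ |
            ⟨hx1, hy4, hyk, hzk⟩)
          · exact Or.inr (Or.inr (Or.inl ⟨z, hz6, hzk,
              (htri _ _ _ (by omega) (by omega)).2 ⟨hx1, hy, rfl⟩⟩))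
          · by_cases hz4 : z = 4
            · exact Or.inl ((htri _ _ _ (by omega) (by omega)).2 ⟨hx1, hy, hz4⟩)
            · exact Or.inr (Or.inr (Or.inr (Or.inr (Or.inl ⟨z, by omega, hzk,
                (htri _ _ _ (by omega) (by omega)).2 ⟨hx1, hy, rfl⟩⟩))))
          · exact Or.inr (Or.inr (Or.inr (Or.inl ⟨x, hx2, hxk,
              (htri _ _ _ (by omega) (by omega)).2 ⟨rfl, hy, hzk⟩⟩)))
          · by_cases hx4 : x = k - 2
            · exact Or.inr (Or.inl ((htri _ _ _ (by omega) (by omega)).2 ⟨hx4, hy, hzk⟩))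
            · exact Or.inr (Or.inr (Or.inr (Or.inr (Or.inr (Or.inl ⟨x, hx2, by omega,
                (htri _ _ _ (by omega) (by omega)).2 ⟨rfl, hy, hzk⟩⟩)))))
          · exact Or.inr (Or.inr (Or.inr (Or.inr (Or.inr (Or.inr ⟨y, hy4, hyk,
              (htri _ _ _ (by omega) (by omega)).2 ⟨hx1, rfl, hzk⟩⟩)))))
        · rintro (h1 | h1 | ⟨i, h2, h3, h1⟩ | ⟨i, h2, h3, h1⟩ | ⟨i, h2, h3, h1⟩ |
            ⟨i, h2, h3, h1⟩ | ⟨i, h2, h3, h1⟩) <;>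
          · rw [htri _ _ _ (by omega) (by omega)] at h1
            omega
      · rintro T (rfl | rfl | ⟨i, -, -, rfl⟩ | ⟨i, -, -, rfl⟩ | ⟨i, -, -, rfl⟩ |
          ⟨i, -, -, rfl⟩ | ⟨i, -, -, rfl⟩) <;>
        exact Finset.card_le_three
    · rw [card_hFoldSumset_iff_one_gap hk' hx hxy hyz hz hP (by omega), hex]
      · constructor
        · rintro (⟨hx2, hyk, hzk⟩ | ⟨hx1, hy4, hzk⟩)
          · by_cases c1 : y = x + 1
            · by_cases c2 : x = 2
              · exact Or.inl ((htri _ _ _ (by omega) (by omega)).2 ⟨c2, by omega, hzk⟩)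
              · exact Or.inr (Or.inr (Or.inl ⟨x, by omega, by omega,
                  (htri _ _ _ (by omega) (by omega)).2 ⟨rfl, c1, hzk⟩⟩))
            · by_cases c2 : y = x + 2
              · exact Or.inr (Or.inr (Or.inr (Or.inr (Or.inl ⟨x, by omega, by omega,
                  (htri _ _ _ (by omega) (by omega)).2 ⟨rfl, c2, hzk⟩⟩))))
              · exact Or.inr (Or.inr (Or.inr (Or.inr (Or.inr (Or.inr (Or.inr ⟨x, y, by omega,
                  by omega, by omega,
                  (htri _ _ _ (by omega) (by omega)).2 ⟨rfl, rfl, hzk⟩⟩))))))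
          · by_cases c1 : z = y + 1
            · by_cases c2 : z = k
              · exact Or.inr (Or.inl ((htri _ _ _ (by omega) (by omega)).2
                  ⟨hx1, by omega, c2⟩))
              · exact Or.inr (Or.inr (Or.inr (Or.inl ⟨y, by omega, by omega,
                  (htri _ _ _ (by omega) (by omega)).2 ⟨hx1, rfl, c1⟩⟩)))
            · by_cases c2 : z = y + 2
              · exact Or.inr (Or.inr (Or.inr (Or.inr (Or.inr (Or.inl ⟨y, by omega, by omega,
                  (htri _ _ _ (by omega) (by omega)).2 ⟨hx1, rfl, c2⟩⟩)))))
              · exact Or.inr (Or.inr (Or.inr (Or.inr (Or.inr (Or.inr (Or.inl ⟨y, z, by omega,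
                  by omega, by omega,
                  (htri _ _ _ (by omega) (by omega)).2 ⟨hx1, rfl, rfl⟩⟩))))))
        · rintro (h1 | h1 | ⟨i, h2, h3, h1⟩ | ⟨i, h2, h3, h1⟩ | ⟨i, h2, h3, h1⟩ |
            ⟨i, h2, h3, h1⟩ | ⟨i, j, h2, h3, h4, h1⟩ | ⟨i, j, h2, h3, h4, h1⟩) <;>
          · rw [htri _ _ _ (by omega) (by omega)] at h1
            omega
      · rintro T (rfl | rfl | ⟨i, -, -, rfl⟩ | ⟨i, -, -, rfl⟩ | ⟨i, -, -, rfl⟩ |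
          ⟨i, -, -, rfl⟩ | ⟨i, j, -, -, -, rfl⟩ | ⟨i, j, -, -, -, rfl⟩) <;>
        exact Finset.card_le_three
    · rw [card_hFoldSumset_iff_no_gap hk' hx hxy hyz hz hP (by omega)]
      constructor
      · exact fun hl => ⟨x, y, z, hl.1, hxy, hyz, hl.2, hA⟩
      · rintro ⟨a, b, c, h1, h2, h3, h4, h5⟩
        have := (hex (fun T => T = {a, b, c}) fun T hT => hT ▸ Finset.card_le_three).1
          ⟨_, h5, rfl⟩
        rw [htri _ _ _ h2 h3] at this
        omega
  -- Now max A ≥ k+3: no T can represent A, and it remains to show that |hA| is too large.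
  · have hnot : ∀ T : Finset ℤ, A ≠ Finset.Icc (0 : ℤ) (k + 2) \ T := by
      intro T hT
      apply hlong
      intro a ha
      rw [hT] at ha
      exact (Finset.mem_Icc.1 (Finset.mem_sdiff.1 ha).1).2
    push Not at hlong
    obtain ⟨a, ha, hak⟩ := hlong
    set n := (A.max' hne).toNat with hn
    have hmax : (n : ℤ) = A.max' hne := Int.toNat_of_nonneg (hnn _ (A.max'_mem hne))
    have hamax := A.le_max' a ha
    have hgcd : ∀ d : ℤ, (∀ a ∈ A, d ∣ a) → IsUnit d := by
      intro d hdA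
      rw [isUnit_iff_dvd_one, ← hd]
      refine Finset.dvd_gcd fun b hb => ?_
      rw [hmin, sub_zero]
      exact hdA b hb
    obtain ⟨h2, hstep⟩ := hFoldSumset_card_of_long (n := n) (by omega) h0
      (hmax ▸ A.max'_mem hne)
      (fun b hb => Finset.mem_Icc.2 ⟨hnn b hb, hmax ▸ A.le_max' b hb⟩) (by omega) hgcd
    rw [hcard] at h2 hstep
    have hgrow : ∀ m : ℕ, (hFoldSumset 2 A).card + m * (k + 3) ≤ (hFoldSumset (m + 2) A).card := by
      intro m
      induction m with
      | zero => simp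
      | succ m ih =>
        have := hstep (m + 2) (by omega)
        rw [show m + 1 + 2 = m + 2 + 1 by ring]
        linarith
    -- |hA| ≥ |2A| + (h-2)(k+3), which is at least hk+3h-3 for k ≥ 6 and hk+3h-4 for k = 5.
    have hlow : ((hFoldSumset 2 A).card : ℤ) + ((h * k + 3 * h) - (2 * k + 6)) ≤
        (hFoldSumset h A).card := by
      obtain ⟨m, rfl⟩ : ∃ m, h = m + 2 := ⟨h - 2, by omega⟩
      have := hgrow m
      push_cast
      have : (((hFoldSumset 2 A).card + m * (k + 3) : ℕ) : ℤ) ≤ (hFoldSumset (m + 2) A).card := by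
        exact_mod_cast this
      push_cast at this
      linarith
    -- The second item concerns 3A whatever h is, so `hlow` does not cover it.
    have h3 : _ ≤ (hFoldSumset 3 A).card := hstep 2 le_rfl
    refine ⟨fun hk6 => ?_, ?_, fun hh4 => ?_, fun hhk => ?_, fun hhk => ?_, fun hhk => ?_⟩
    · exact iff_of_false (by omega) fun ⟨T, hT, _⟩ => hnot T hT
    · exact iff_of_false (by omega) fun ⟨T, hT, _⟩ => hnot T hT
    · exact iff_of_false (by omega) fun ⟨T, hT, _⟩ => hnot T hT
    · exact iff_of_false (by omega) fun ⟨T, hT, _⟩ => hnot T hT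
    · exact iff_of_false (by omega) fun ⟨T, hT, _⟩ => hnot T hT
    · exact iff_of_false (by omega) fun ⟨x, y, z, _, _, _, _, hT⟩ => hnot _ hT
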